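/- Let $K$ be a field, $\sigma$ an automorphism of $K$ of finite order $n$, $F=\mathrm{Fix}(\sigma)$, and $R=K[t;\sigma]$ the skew polynomial ring with $ta=\sigma(a)t$, whose center is $F[t^n]$. Let $\rho\in\mathrm{Aut}(K)$ be such that $F$ is a finite extension of $F'=\mathrm{Fix}(\rho)\cap F$. Let $f=\sum_{i=0}^m a_it^i\in R$ be monic and irreducible of degree $m>1$ (so $a_0\neq 0$). Let $h=\hat h(t^n)$ be the minimal central left multiple of $f$: $\hat h\in F[x]$ is the monic polynomial of least degree with $\hat h(t^n)\in Rf$. Put $E_{\hat h}=F[x]/(\hat h)$. Suppose $\deg h=mn$, and let $1<l<n$ be an integer and $\nu\in K$ with $$N_{K/F'}(\nu)\neq \frac{1}{N_{K/F'}(a_0)^{l}}.$$ Then $E_{\hat h}$ is a field; the right nucleus $B=\{g+Rf: fg\in Rf\}$ of the Petit algebra $S_f$ (the space $R/Rf$, represented by remainders modulo $f$) is the image of $F[t^n]$ in $R/Rf$, so that $B\cong E_{\hat h}$; and $V_f=R/Rf$ is a vector space over $E_{\hat h}$ of dimension $n$ via $(a+Rf)\cdot p=a\,p(t^n)+Rf$.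 Moreover, let $$S_{n,m,l}(\nu,\rho,f)=\{a+Rh : a=d_0+d_1t+\dots+d_{lm-1}t^{lm-1}+\nu\rho(d_0)t^{lm},\ d_i\in K\}\subset R/Rh.$$ For $a+Rh\in R/Rh$ let $M_a\in M_n(E_{\hat h})$ be the matrix of the $E_{\hat h}$-linear map $L_a:V_f\to V_f$, $b+Rf\mapsto ab+Rf$, with respect to a fixed (arbitrary) $E_{\hat h}$-basis of $V_f$. Then the code $$\mathcal C=\{M_a : a+Rh\in S_{n,m,l}(\nu,\rho,f)\}\subset M_n(E_{\hat h})$$ is an $F'$-linear MRD code with minimum distance $d=n-l+1$: it is an $F'$-subspace of $M_n(E_{\hat h})$, the minimum of $\mathrm{rank}(M-N)$ over distinct $M,N\in\mathcal C$ is $n-l+1$, and it attains the Singleton-like bound, $\dim_{F'}\mathcal C=n(n-d+1)[E_{\hat h}:F']$. -/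

import Mathlib

noncomputable section

namespace SkewMRD

section Setup

variable (K : Type*) [Field K] [MulSemiringAction (Multiplicative ℕ) K]

/-- The twist `σ` of the skew polynomial ring `R = K[t;σ] = SkewPolynomial K`, in which
`t * a = σ a * t`. -/
abbrev sigma : K →+* K := SkewPolynomial.φ

/-- `F = Fix(σ)`. -/
abbrev F : Subfield K := (sigma K).eqLocusField (RingHom.id K)

/-- `F' = Fix(ρ) ∩ F`, as a subfield of `F`. -/
abbrev F' (ρ : K ≃+* K) : Subfield (F K) :=
  ((ρ : K →+* K).comp (F K).subtype).eqLocusField (F K).subtype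

theorem sigma_coe (a : F K) : sigma K (a : K) = a := a.2

theorem commute_C_X_pow (a : F K) (j : ℕ) :
    Commute (SkewPolynomial.CRingHom (a : K)) ((SkewPolynomial.X : SkewPolynomial K) ^ j) := by
  refine Commute.pow_right ?_ j
  change _ * _ = _ * _
  rw [SkewPolynomial.CRingHom_eq_C, SkewPolynomial.X_mul,
    SkewPolynomial.sum_C_index (by simp)]
  have h := sigma_coe K a
  simp only [sigma] at h
  rw [h]
  rfl

/-- The ring homomorphism `F[x] → R`, `p ↦ p(t ^ n)`, where `n` is the order of `σ`. -/
def central : Polynomial (F K) →+* SkewPolynomial K :=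
  Polynomial.eval₂RingHom' (SkewPolynomial.CRingHom.comp (F K).subtype)
    (SkewPolynomial.X ^ orderOf (sigma K)) fun a => commute_C_X_pow K a _

theorem X_pow_commute (r : SkewPolynomial K) :
    Commute ((SkewPolynomial.X : SkewPolynomial K) ^ orderOf (sigma K)) r := by
  change _ * _ = _ * _
  have h : ∀ b : K, (sigma K)^[orderOf (sigma K)] b = b := by
    intro b
    rw [← RingHom.coe_pow, pow_orderOf_eq_one]
    rfl
  rw [SkewPolynomial.X_pow_mul]
  simp only [sigma] at h
  simp only [h, SkewPolynomial.sum_monomial]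

theorem central_commute (p : Polynomial (F K)) (r : SkewPolynomial K) :
    Commute (central K p) r := by
  induction p using Polynomial.induction_on' with
  | add p q hp hq => rw [map_add]; exact hp.add_left hq
  | monomial j a =>
    change Commute (Polynomial.eval₂ _ _ _) r
    rw [Polynomial.eval₂_monomial]
    induction r using SkewPolynomial.induction with
    | h0 => exact Commute.zero_right _
    | ha i b q _ _ hq =>
      refine Commute.add_right ?_ hq
      refine Commute.mul_left ?_ ((X_pow_commute K _).pow_left j)
      change _ * _ = _ * _
      have h : ∀ i : ℕ, (sigma K)^[i] (a : K) = a := fun i => by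
        induction i with
        | zero => rfl
        | succ i ih => rw [Function.iterate_succ_apply', ih, sigma_coe]
      simp only [sigma] at h
      rw [RingHom.comp_apply, SkewPolynomial.CRingHom_eq_C]
      simp [h, mul_comm]

end Setup

variable {K : Type*} [Field K] [MulSemiringAction (Multiplicative ℕ) K]

/-- The degree of a skew polynomial, with `deg 0 = -∞`. -/
def deg (p : SkewPolynomial K) : WithBot ℕ := p.support.max

/-- `hhat(t ^ n)` is the minimal central left multiple of `f`: `hhat ∈ F[x]` is monic,
`hhat(t ^ n) = g * f` for some `g`, and `hhat` has minimal degree among such polynomials. -/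
structure IsMCLM (f : SkewPolynomial K) (hhat : Polynomial (F K)) : Prop where
  monic : hhat.Monic
  left_multiple : ∃ g : SkewPolynomial K, central K hhat = g * f
  minimal : ∀ p : Polynomial (F K), p.Monic →
    (∃ g : SkewPolynomial K, central K p = g * f) → hhat.degree ≤ p.degree

/-- `V_f = R / R f` (the arguments `hhat` and `hh` serve to give it its structure as a vector
space over `E = F[x] / (hhat)`). -/
def V (f : SkewPolynomial K) (hhat : Polynomial (F K)) (_hh : IsMCLM f hhat) : Type _ :=
  SkewPolynomial K ⧸ Submodule.span (SkewPolynomial K) {f}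

namespace V

variable {f : SkewPolynomial K} {hhat : Polynomial (F K)} (hh : IsMCLM f hhat)

instance : AddCommGroup (V f hhat hh) :=
  inferInstanceAs (AddCommGroup (SkewPolynomial K ⧸ Submodule.span (SkewPolynomial K) {f}))

instance : Module (SkewPolynomial K) (V f hhat hh) :=
  inferInstanceAs (Module (SkewPolynomial K)
    (SkewPolynomial K ⧸ Submodule.span (SkewPolynomial K) {f}))

/-- The class `a + R f`. -/
def mk : SkewPolynomial K →ₗ[SkewPolynomial K] V f hhat hh :=
  (Submodule.span (SkewPolynomial K) {f}).mkQ

theorem mk_surjective : Function.Surjective (mk hh) := Submodule.mkQ_surjective _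

theorem central_smul_mk (p : Polynomial (F K)) (a : SkewPolynomial K) :
    central K p • mk hh a = mk hh (a * central K p) := by
  rw [← map_smul, smul_eq_mul, (central_commute K p a).eq]

theorem central_hhat_smul (v : V f hhat hh) : central K hhat • v = 0 := by
  obtain ⟨a, rfl⟩ := mk_surjective hh v
  obtain ⟨g, hg⟩ := hh.left_multiple
  rw [central_smul_mk, hg, ← mul_assoc]
  exact (Submodule.Quotient.mk_eq_zero _).2
    (Submodule.mem_span_singleton.2 ⟨a * g, rfl⟩)

/-- The action of `E = F[x] / (hhat)` on `V_f`, induced by `p ↦ (v ↦ p(t ^ n) v)`. -/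
def scalar : AdjoinRoot hhat →+* AddMonoid.End (V f hhat hh) :=
  Ideal.Quotient.lift (Ideal.span {hhat})
    ((Module.toAddMonoidEnd (SkewPolynomial K) (V f hhat hh)).comp (central K)) (by
      intro p hp
      obtain ⟨q, rfl⟩ := Ideal.mem_span_singleton'.1 hp
      ext v
      change central K (q * hhat) • v = 0
      rw [map_mul, mul_smul, central_hhat_smul, smul_zero])

instance : Module (AdjoinRoot hhat) (V f hhat hh) :=
  Module.compHom (V f hhat hh) (scalar hh)

/-- The scalar multiplication is `(a + R f) (p(t ^ n) + R f) = a p(t ^ n) + R f`. -/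
theorem smul_mk (p : Polynomial (F K)) (a : SkewPolynomial K) :
    AdjoinRoot.mk hhat p • mk hh a = mk hh (a * central K p) :=
  central_smul_mk hh p a

instance : SMulCommClass (AdjoinRoot hhat) (SkewPolynomial K) (V f hhat hh) where
  smul_comm e r v := by
    obtain ⟨p, rfl⟩ := AdjoinRoot.mk_surjective e
    change central K p • r • v = r • central K p • v
    rw [← mul_smul, ← mul_smul, (central_commute K p r).eq]

end V

/-- `L : R / R h → End_E(V_f)`, `a + R h ↦ L_a`, where `h = hhat(t ^ n)` and `L_a` is left
multiplication by `a`. -/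
def L {f : SkewPolynomial K} {hhat : Polynomial (F K)} (hh : IsMCLM f hhat) :
    (SkewPolynomial K ⧸ Submodule.span (SkewPolynomial K) {central K hhat})
      →ₗ[SkewPolynomial K] (V f hhat hh →ₗ[AdjoinRoot hhat] V f hhat hh) :=
  Submodule.liftQSpanSingleton (central K hhat)
    (LinearMap.toSpanSingleton (SkewPolynomial K) _ LinearMap.id) (by
      ext v
      exact V.central_hhat_smul hh v)

theorem L_mk {f : SkewPolynomial K} {hhat : Polynomial (F K)} (hh : IsMCLM f hhat)
    (a b : SkewPolynomial K) :
    L hh (Submodule.Quotient.mk a) (V.mk hh b) = V.mk hh (a * b) := rfl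

/-- The right nucleus `B` of the Petit algebra `R / R f`, that is, the set of all `g + R f` with
`f g ∈ R f`. -/
def rightNucleus {f : SkewPolynomial K} {hhat : Polynomial (F K)} (hh : IsMCLM f hhat) :
    Set (V f hhat hh) :=
  V.mk hh '' {g | ∃ q : SkewPolynomial K, f * g = q * f}

/-- The set `A` of all `d_0 + d_1 t + ⋯ + d_{N-1} t ^ (N-1) + ν ρ(d_0) t ^ N`. -/
def A (ν : K) (ρ : K ≃+* K) (N : ℕ) : Set (SkewPolynomial K) :=
  {a | ∃ d : ℕ → K, a = ∑ i ∈ Finset.range N, SkewPolynomial.monomial i (d i)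
    + SkewPolynomial.monomial N (ν * ρ (d 0))}

/-- `S_{n,m,l}(ν,ρ,f) = {a + R h | a ∈ A} ⊆ R / R h`, where `h = hhat(t ^ n)`. -/
def S (m l : ℕ) (ν : K) (ρ : K ≃+* K) (hhat : Polynomial (F K)) :
    Set (SkewPolynomial K ⧸ Submodule.span (SkewPolynomial K) {central K hhat}) :=
  Submodule.Quotient.mk '' A ν ρ (l * m)

/-- The code `{M_a | a ∈ S_{n,m,l}(ν,ρ,f)}`, where `M_a` is the matrix of `L_a` with respect
to the basis `b` of `V_f`. -/
def code {f : SkewPolynomial K} {hhat : Polynomial (F K)} (hh : IsMCLM f hhat) {n : ℕ}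
    (b : Module.Basis (Fin n) (AdjoinRoot hhat) (V f hhat hh))
    (m l : ℕ) (ν : K) (ρ : K ≃+* K) : Set (Matrix (Fin n) (Fin n) (AdjoinRoot hhat)) :=
  (fun a => LinearMap.toMatrix b b (L hh a)) '' S m l ν ρ hhat

/-- `d` is the minimum distance of the code `C` for the rank distance
`d(M, N) = rank (M - N)`. -/
def IsMinDist {E : Type*} [CommRing E] {n : ℕ} (C : Set (Matrix (Fin n) (Fin n) E)) (d : ℕ) :
    Prop :=
  IsLeast {r | ∃ M ∈ C, ∃ N ∈ C, M ≠ N ∧ r = (M - N).rank} d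

/-- `C` is a `k`-linear MRD code with minimum distance `d` in `M_n(E)`, `E` a finite extension of
the field `k`: it is a `k`-vector space and attains the Singleton-like bound
`dim_k C ≤ n (n - d + 1) [E : k]`. -/
def IsLinearMRD (k : Type*) {E : Type*} [Field k] [CommRing E] [Algebra k E] {n : ℕ}
    (C : Set (Matrix (Fin n) (Fin n) E)) (d : ℕ) : Prop :=
  Module.Finite k E ∧ IsMinDist C d ∧
    ∃ W : Submodule k (Matrix (Fin n) (Fin n) E), (W : Set (Matrix (Fin n) (Fin n) E)) = C ∧
      Module.finrank k W = n * (n - d + 1) * Module.finrank k E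

end SkewMRD

end

noncomputable section

namespace SkewMRD

/-! ### Degrees, right division and left ideals in `R` -/

section Degree
open SkewPolynomial

variable {K : Type*} [Field K]

/-! Everything happens in the left `R`-module `V = R/Rf`, which is simple because left ideals of `R`
are principal and `f` is irreducible. A central element killing one nonzero vector kills all of `V`;
this makes `hhat` irreducible. Counting over `F`, `[V:K][K:F] = mn` and `[E:F] = m`, so `[V:E] = n`.

The key fact is that `R → End_E(V)` is onto (`exists_smul_eq_end`). A monic annihilator of `V` of
least degree commutes with `t` and semi-commutes with `K`, so it is `c(t^n) t^r`; as `t` acts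
surjectively, `deg c ≥ m`. Thus skew polynomials of degree `< mn` act faithfully, and they form an
`F`-space of dimension `mn²`, the same as `End_E(V)`. The right nucleus follows by a double
centralizer argument.

For the distance, let `a` of degree `e` kill `l` vectors `x_i` independent over `E`. By surjectivity
`x = (x_i)` generates `V^l`, so `x, tx, …, t^(e-1) x` span it over `K` and `lm ≤ e`. If `e = lm`
they form a basis in which `t` acts by the companion matrix of `a`, while in the obvious basis it
acts by `l` companion blocks of `f`. Changing basis multiplies the determinant of a `σ`-semilinear
map by some `σ(δ)/δ`, of norm 1, so `N(a_0/a_e) = N(f_0)^l` (`le_isDegree_of_linearIndependent`).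
For a codeword `a_0/a_e = d_0/(ν ρ(d_0))`, and this is the excluded value of `N(ν)`. So kernels have
dimension `< l`; injectivity of the parametrization and a dimension count give the rest. -/

theorem coeff_smul' (c : K) (q : SkewPolynomial K) (i : ℕ) : (c • q).coeff i = c * q.coeff i := rfl

theorem coeff_sum' {ι : Type*} (s : Finset ι) (g : ι → SkewPolynomial K) (i : ℕ) :
    (∑ j ∈ s, g j).coeff i = ∑ j ∈ s, (g j).coeff i := by
  classical
  induction s using Finset.induction_on with
  | empty => simp
  | insert j s hj ih => rw [Finset.sum_insert hj, Finset.sum_insert hj, coeff_add, ih]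

/-- `p` is a nonzero skew polynomial of degree `d`. -/
def IsDegree (p : SkewPolynomial K) (d : ℕ) : Prop :=
  p.coeff d ≠ 0 ∧ ∀ i, d < i → p.coeff i = 0

theorem IsDegree.ne_zero {p : SkewPolynomial K} {d : ℕ} (h : IsDegree p d) : p ≠ 0 := by
  rintro rfl; exact h.1 rfl

theorem IsDegree.unique {p : SkewPolynomial K} {d e : ℕ} (h : IsDegree p d) (h' : IsDegree p e) :
    d = e := by
  rcases lt_trichotomy d e with hl | hl | hl
  · exact (h'.1 (h.2 _ hl)).elim
  · exact hl
  · exact (h.1 (h'.2 _ hl)).elim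

theorem isDegree_of_deg {p : SkewPolynomial K} {d : ℕ} (h : deg p = d) : IsDegree p d := by
  refine ⟨mem_support_iff.1 (Finset.mem_of_max h), fun i hi => ?_⟩
  by_contra hc
  have := Finset.le_max (mem_support_iff.2 hc)
  rw [deg] at h
  rw [h] at this
  exact absurd (WithBot.coe_le_coe.1 this) (not_le.2 hi)

theorem exists_isDegree {p : SkewPolynomial K} (hp : p ≠ 0) : ∃ d, IsDegree p d := by
  obtain ⟨d, hd⟩ := Finset.max_of_nonempty
    (Finset.nonempty_iff_ne_empty.2 (fun h => hp (support_eq_empty.1 h)))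
  exact ⟨d, isDegree_of_deg hd⟩

theorem exists_isDegree_lt {p : SkewPolynomial K} (hp : p ≠ 0) {d : ℕ}
    (h : ∀ i, d ≤ i → p.coeff i = 0) : ∃ e < d, IsDegree p e := by
  obtain ⟨e, he⟩ := exists_isDegree hp
  refine ⟨e, ?_, he⟩
  by_contra hc
  exact he.1 (h e (by omega))

theorem eq_monomial_add_of_le {p : SkewPolynomial K} {d : ℕ} (h : ∀ i, d < i → p.coeff i = 0) :
    ∃ q : SkewPolynomial K, p = monomial d (p.coeff d) + q ∧ ∀ i, d ≤ i → q.coeff i = 0 := by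
  refine ⟨p - monomial d (p.coeff d), by abel, fun i hi => ?_⟩
  rw [coeff_sub, coeff_monomial]
  rcases hi.eq_or_lt with rfl | hi
  · simp
  · rw [if_neg (by omega), h i hi, sub_zero]

variable [MulSemiringAction (Multiplicative ℕ) K]

theorem coeff_monomial_mul (d : ℕ) (c : K) (q : SkewPolynomial K) (i : ℕ) :
    (monomial d c * q).coeff (d + i) = c * (sigma K ^ d) (q.coeff i) := by
  induction q using SkewPolynomial.induction with
  | h0 => simp
  | ha j b q _ _ hq =>
    rw [mul_add, coeff_add, hq, coeff_add, monomial_mul_monomial, coeff_monomial, coeff_monomial,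
      map_add, mul_add, RingHom.coe_pow]
    congr 1
    by_cases h : j = i <;> simp [h]

theorem coeff_monomial_mul_of_lt {d i : ℕ} (h : i < d) (c : K) (q : SkewPolynomial K) :
    (monomial d c * q).coeff i = 0 := by
  induction q using SkewPolynomial.induction with
  | h0 => simp
  | ha j b q _ _ hq =>
    rw [mul_add, coeff_add, hq, monomial_mul_monomial, coeff_monomial, if_neg (by omega), add_zero]

theorem coeff_mul_C (q : SkewPolynomial K) (a : K) (i : ℕ) :
    (q * C a).coeff i = q.coeff i * (sigma K ^ i) a := by
  induction q using SkewPolynomial.induction with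
  | h0 => simp
  | ha j b q _ _ hq =>
    rw [add_mul, coeff_add, hq, coeff_add, monomial_mul_C, coeff_monomial, coeff_monomial,
      add_mul, RingHom.coe_pow]
    congr 1
    by_cases h : j = i <;> simp [h]

theorem coeff_mul_X_succ (q : SkewPolynomial K) (i : ℕ) : (q * X).coeff (i + 1) = q.coeff i := by
  induction q using SkewPolynomial.induction with
  | h0 => simp
  | ha j b q _ _ hq =>
    rw [add_mul, coeff_add, hq, coeff_add, monomial_mul_X, coeff_monomial, coeff_monomial]
    simp

theorem coeff_mul_X_zero (q : SkewPolynomial K) : (q * X).coeff 0 = 0 := by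
  induction q using SkewPolynomial.induction with
  | h0 => simp
  | ha j b q _ _ hq =>
    rw [add_mul, coeff_add, hq, monomial_mul_X, coeff_monomial]
    simp

theorem C_mul_eq_smul (c : K) (q : SkewPolynomial K) : C c * q = c • q := by
  ext i
  have := coeff_monomial_mul 0 c q i
  rw [zero_add, pow_zero] at this
  rw [coeff_smul']; exact this

theorem coeff_mul_of_lt {d e : ℕ} {p q : SkewPolynomial K} (hp : ∀ i, d < i → p.coeff i = 0)
    (hq : ∀ i, e < i → q.coeff i = 0) {i : ℕ} (hi : d + e < i) : (p * q).coeff i = 0 := by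
  induction d using Nat.strong_induction_on generalizing p i with
  | _ d ih =>
    obtain ⟨r, hr, hr'⟩ := eq_monomial_add_of_le hp
    have h1 : (monomial d (p.coeff d) * q).coeff i = 0 := by
      obtain ⟨j, rfl⟩ := Nat.exists_eq_add_of_le (show d ≤ i by omega)
      rw [coeff_monomial_mul, hq j (by omega), map_zero, mul_zero]
    rw [hr, add_mul, coeff_add, h1, zero_add]
    rcases Nat.eq_zero_or_pos d with rfl | hd
    · rw [show r = 0 from SkewPolynomial.ext fun j => hr' j (Nat.zero_le _), zero_mul, coeff_zero]
    · exact ih (d - 1) (by omega) (fun j hj => hr' j (by omega)) (by omega)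

theorem coeff_mul_add {d e : ℕ} {p q : SkewPolynomial K} (hp : ∀ i, d < i → p.coeff i = 0)
    (hq : ∀ i, e < i → q.coeff i = 0) :
    (p * q).coeff (d + e) = p.coeff d * (sigma K ^ d) (q.coeff e) := by
  obtain ⟨r, hr, hr'⟩ := eq_monomial_add_of_le hp
  have h1 := coeff_monomial_mul d (p.coeff d) q e
  have h2 : (r * q).coeff (d + e) = 0 := by
    rcases Nat.eq_zero_or_pos d with rfl | hd
    · rw [show r = 0 from SkewPolynomial.ext fun j => hr' j (Nat.zero_le _), zero_mul, coeff_zero]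
    · exact coeff_mul_of_lt (d := d - 1) (fun j hj => hr' j (by omega)) hq (by omega)
  conv_lhs => rw [hr]
  rw [add_mul, coeff_add, h1, h2, add_zero]

theorem sigma_pow_ne_zero (d : ℕ) {a : K} (ha : a ≠ 0) : (sigma K ^ d) a ≠ 0 :=
  (map_ne_zero_iff _ (sigma K ^ d).injective).2 ha

theorem IsDegree.mul {p q : SkewPolynomial K} {d e : ℕ} (hp : IsDegree p d) (hq : IsDegree q e) :
    IsDegree (p * q) (d + e) :=
  ⟨by rw [coeff_mul_add hp.2 hq.2]; exact mul_ne_zero hp.1 (sigma_pow_ne_zero _ hq.1),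
    fun _ hi => coeff_mul_of_lt hp.2 hq.2 hi⟩

theorem exists_reduce {g p : SkewPolynomial K} {d e : ℕ} (hg : IsDegree g d) (hde : d ≤ e)
    (hp : ∀ i, e < i → p.coeff i = 0) :
    ∃ q : SkewPolynomial K, ∀ i, e ≤ i → (p - q * g).coeff i = 0 := by
  obtain ⟨k, rfl⟩ := Nat.exists_eq_add_of_le' hde
  -- Since `t^k g_d = σ^k(g_d) t^k`, this is the coefficient that cancels the top term.
  refine ⟨monomial k (p.coeff (k + d) / (sigma K ^ k) (g.coeff d)), fun i hi => ?_⟩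
  obtain ⟨j, rfl⟩ := Nat.exists_eq_add_of_le hi
  rw [coeff_sub, add_assoc, coeff_monomial_mul]
  rcases Nat.eq_zero_or_pos j with rfl | hj
  · rw [add_zero, div_mul_cancel₀ _ (sigma_pow_ne_zero _ hg.1), sub_self]
  · rw [← add_assoc, hp _ (by omega), hg.2 (d + j) (by omega), map_zero, mul_zero, sub_zero]

/-- An element of least degree of a left ideal generates it. -/
theorem exists_eq_mul_of_minimal (I : Submodule (SkewPolynomial K) (SkewPolynomial K))
    {g : SkewPolynomial K} {d : ℕ} (hgI : g ∈ I) (hg : IsDegree g d)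
    (hmin : ∀ p ∈ I, ∀ e, IsDegree p e → d ≤ e) (p : SkewPolynomial K) (hp : p ∈ I) :
    ∃ q, p = q * g := by
  by_cases h0 : p = 0
  · exact ⟨0, by rw [h0, zero_mul]⟩
  obtain ⟨e, he⟩ := exists_isDegree h0
  induction e using Nat.strong_induction_on generalizing p with
  | _ e ih =>
    obtain ⟨q, hq⟩ := exists_reduce hg (hmin p hp e he) he.2
    have hmem : p - q * g ∈ I := I.sub_mem hp (I.smul_mem q hgI)
    by_cases h1 : p - q * g = 0
    · exact ⟨q, sub_eq_zero.1 h1⟩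
    · obtain ⟨e', he', hd'⟩ := exists_isDegree_lt h1 hq
      obtain ⟨q', hq'⟩ := ih e' he' _ hmem h1 hd'
      exact ⟨q' + q, by rw [add_mul, ← hq']; abel⟩

theorem exists_minimal_isDegree (I : Submodule (SkewPolynomial K) (SkewPolynomial K))
    {p : SkewPolynomial K} (hp : p ∈ I) (h0 : p ≠ 0) :
    ∃ g ∈ I, ∃ d, IsDegree g d ∧ ∀ p ∈ I, ∀ e, IsDegree p e → d ≤ e := by
  classical
  have hex : ∃ d, ∃ g ∈ I, IsDegree g d := by
    obtain ⟨d, hd⟩ := exists_isDegree h0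
    exact ⟨d, p, hp, hd⟩
  obtain ⟨g, hgI, hg⟩ := Nat.find_spec hex
  exact ⟨g, hgI, _, hg, fun q hq e he => Nat.find_min' hex ⟨q, hq, he⟩⟩

/-- `Rg + Rf = Rd` for some `d`, and `f = cd`. If `c` were a unit, `g` would lie in `Rd = Rf`; so
`d` is a unit. -/
theorem mem_span_of_irreducible {f g : SkewPolynomial K} (hf : Irreducible f)
    (hg : g ∉ Submodule.span (SkewPolynomial K) {f}) : ∃ r s : SkewPolynomial K, r * g + s * f = 1 := by
  let I := Submodule.span (SkewPolynomial K) {g, f}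
  have hgI : g ∈ I := Submodule.subset_span (by simp)
  have hfI : f ∈ I := Submodule.subset_span (by simp)
  obtain ⟨d, hdI, e, hde, hmin⟩ := exists_minimal_isDegree I hfI hf.ne_zero
  obtain ⟨c, hc⟩ := exists_eq_mul_of_minimal I hdI hde hmin f hfI
  obtain ⟨q, hq⟩ := exists_eq_mul_of_minimal I hdI hde hmin g hgI
  obtain ⟨r, s, hrs⟩ := Submodule.mem_span_pair.1 hdI
  rcases hf.isUnit_or_isUnit hc with h | h
  · obtain ⟨u, rfl⟩ := h
    refine (hg (Submodule.mem_span_singleton.2 ⟨q * ↑u⁻¹, ?_⟩)).elim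
    rw [hc, hq, smul_eq_mul, mul_assoc, Units.inv_mul_cancel_left]
  · obtain ⟨u, rfl⟩ := h
    refine ⟨↑u⁻¹ * r, ↑u⁻¹ * s, ?_⟩
    rw [mul_assoc, mul_assoc, ← mul_add]
    simp only [smul_eq_mul] at hrs
    rw [hrs, Units.inv_mul]

end Degree

/-! ### Central polynomials `p(t^n)` -/

section Central
open SkewPolynomial
variable {K : Type*} [Field K] [MulSemiringAction (Multiplicative ℕ) K]

theorem central_eq_sum (p : Polynomial (F K)) :
    central K p = p.sum fun j a => monomial (orderOf (sigma K) * j) (a : K) := by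
  change Polynomial.eval₂ _ _ _ = _
  rw [Polynomial.eval₂_eq_sum]
  refine Finset.sum_congr rfl fun j _ => ?_
  beta_reduce
  rw [← pow_mul]
  exact C_mul_X_pow_eq_monomial (n := orderOf (sigma K) * j)

theorem coeff_central (hn : 0 < orderOf (sigma K)) (p : Polynomial (F K)) (j : ℕ) :
    (central K p).coeff (orderOf (sigma K) * j) = p.coeff j := by
  rw [central_eq_sum, Polynomial.sum, coeff_sum']
  simp only [coeff_monomial, mul_right_inj' hn.ne']
  rw [Finset.sum_ite_eq' p.support j (fun i => ((p.coeff i : F K) : K))]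
  split_ifs with h
  · rfl
  · rw [Polynomial.notMem_support_iff.1 h]; rfl

theorem coeff_central_of_not_dvd (p : Polynomial (F K)) {i : ℕ} (h : ¬ orderOf (sigma K) ∣ i) :
    (central K p).coeff i = 0 := by
  rw [central_eq_sum, Polynomial.sum, coeff_sum']
  refine Finset.sum_eq_zero fun j _ => ?_
  rw [coeff_monomial, if_neg]
  rintro rfl
  exact h (dvd_mul_right _ _)

theorem isDegree_central (hn : 0 < orderOf (sigma K)) {p : Polynomial (F K)} (hp : p ≠ 0) :
    IsDegree (central K p) (orderOf (sigma K) * p.natDegree) := by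
  constructor
  · rw [coeff_central hn]
    simpa using hp
  · intro i hi
    by_cases h : orderOf (sigma K) ∣ i
    · obtain ⟨j, rfl⟩ := h
      rw [coeff_central hn, Polynomial.coeff_eq_zero_of_natDegree_lt
        (Nat.lt_of_mul_lt_mul_left hi)]
      rfl
    · exact coeff_central_of_not_dvd p h

theorem central_X : central K Polynomial.X = X ^ orderOf (sigma K) := by
  change Polynomial.eval₂ _ _ _ = _
  rw [Polynomial.eval₂_X]

theorem central_C (a : F K) : central K (Polynomial.C a) = C (a : K) := by
  change Polynomial.eval₂ _ _ _ = _
  rw [Polynomial.eval₂_C]; rfl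

theorem dvd_of_sigma_pow_eq {i k : ℕ} (hn : 0 < orderOf (sigma K))
    (h : sigma K ^ i = sigma K ^ (i + k)) : orderOf (sigma K) ∣ k := by
  apply orderOf_dvd_of_pow_eq_one
  have h1 : sigma K ^ (orderOf (sigma K) * i) = 1 := by rw [pow_mul, pow_orderOf_eq_one, one_pow]
  have h2 : orderOf (sigma K) * i = (orderOf (sigma K) * i - i) + i := by
    have := Nat.le_mul_of_pos_left i hn
    omega
  -- Cancels `σ^i` inside the monoid of endomorphisms: its inverse is `σ^(ni - i)`.
  calc sigma K ^ k = sigma K ^ (orderOf (sigma K) * i) * sigma K ^ k := by rw [h1, one_mul]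
    _ = sigma K ^ (orderOf (sigma K) * i - i) * sigma K ^ (i + k) := by
        rw [← pow_add, ← pow_add]; congr 1; omega
    _ = 1 := by rw [← h, ← pow_add, ← h2, h1]

end Central

/-! ### Cyclic modules over `R` and the vectors `t^j x` -/

section Cyclic
open SkewPolynomial
variable {K : Type*} [Field K]

theorem eq_sum_of_coeff_eq_zero [MulSemiringAction (Multiplicative ℕ) K] {p : SkewPolynomial K}
    {d : ℕ} (h : ∀ i, d ≤ i → p.coeff i = 0) :
    p = ∑ j : Fin d, p.coeff j • (X : SkewPolynomial K) ^ (j : ℕ) := by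
  ext i
  rw [Fin.sum_univ_eq_sum_range (fun j => p.coeff j • (X : SkewPolynomial K) ^ j) d, coeff_sum']
  simp only [coeff_smul', X_pow_eq_monomial, coeff_monomial, mul_ite, mul_one, mul_zero]
  rw [Finset.sum_ite_eq']
  split_ifs with hi
  · rfl
  · exact h i (by simpa using hi)

variable [MulSemiringAction (Multiplicative ℕ) K]

/-- The skew polynomial `∑ c_j t ^ j`. -/
def ofCoeffs {d : ℕ} (c : Fin d → K) : SkewPolynomial K :=
  ∑ j, c j • (X : SkewPolynomial K) ^ (j : ℕ)

theorem coeff_ofCoeffs {d : ℕ} (c : Fin d → K) (i : ℕ) :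
    (ofCoeffs c).coeff i = ∑ j : Fin d, if (j : ℕ) = i then c j else 0 := by
  rw [ofCoeffs, coeff_sum']
  simp only [coeff_smul', X_pow_eq_monomial, coeff_monomial, mul_ite, mul_one, mul_zero]

theorem coeff_ofCoeffs_of_le {d : ℕ} (c : Fin d → K) {i : ℕ} (hi : d ≤ i) :
    (ofCoeffs c).coeff i = 0 := by
  rw [coeff_ofCoeffs]; exact Finset.sum_eq_zero fun j _ => if_neg (by omega)

theorem eq_zero_of_ofCoeffs_eq_zero {d : ℕ} {c : Fin d → K} (h : ofCoeffs c = 0) (j : Fin d) :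
    c j = 0 := by
  have h' := coeff_ofCoeffs c j
  rw [h, coeff_zero] at h'
  simpa [Fin.val_inj] using h'.symm

theorem exists_division {g : SkewPolynomial K} {d : ℕ} (hg : IsDegree g d) (p : SkewPolynomial K) :
    ∃ q : SkewPolynomial K, ∀ i, d ≤ i → (p - q * g).coeff i = 0 := by
  suffices H : ∀ e, ∀ p : SkewPolynomial K, (∀ i, d + e ≤ i → p.coeff i = 0) →
      ∃ q : SkewPolynomial K, ∀ i, d ≤ i → (p - q * g).coeff i = 0 by
    by_cases h0 : p = 0
    · exact ⟨0, fun i _ => by rw [h0, zero_mul, sub_zero, coeff_zero]⟩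
    obtain ⟨e, he⟩ := exists_isDegree h0
    exact H (e + 1) p fun i hi => he.2 i (by omega)
  intro e
  induction e with
  | zero => exact fun p hp => ⟨0, by simpa using hp⟩
  | succ e ih =>
    intro p hp
    obtain ⟨q, hq⟩ := exists_reduce hg (Nat.le_add_right d e) (p := p) fun i hi => hp i (by omega)
    obtain ⟨q', hq'⟩ := ih _ hq
    exact ⟨q + q', fun i hi => by rw [add_mul, ← sub_sub]; exact hq' i hi⟩

variable {M : Type*} [AddCommGroup M] [Module K M] [Module (SkewPolynomial K) M]
  [IsScalarTower K (SkewPolynomial K) M]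

theorem C_smul (c : K) (x : M) : (C c : SkewPolynomial K) • x = c • x := by
  rw [← mul_one (C c), C_mul_eq_smul, smul_assoc, one_smul]

theorem X_smul_smul (c : K) (x : M) :
    (X : SkewPolynomial K) • c • x = sigma K c • (X : SkewPolynomial K) • x := by
  rw [← C_smul c x, ← C_smul (sigma K c), ← mul_smul, ← mul_smul]
  congr 1
  have h1 : (X : SkewPolynomial K) * monomial 0 c = monomial 1 (sigma K c) := X_mul_monomial 0 c
  have h2 : (C (sigma K c) : SkewPolynomial K) * X = monomial 1 (sigma K c) := C_mul_X_eq_monomial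
  rw [h2, ← h1]; rfl

theorem smul_eq_sum_of_coeff_eq_zero {p : SkewPolynomial K} {d : ℕ}
    (h : ∀ i, d ≤ i → p.coeff i = 0) (x : M) :
    p • x = ∑ j : Fin d, p.coeff j • (X : SkewPolynomial K) ^ (j : ℕ) • x := by
  conv_lhs => rw [eq_sum_of_coeff_eq_zero h]
  rw [Finset.sum_smul]
  exact Finset.sum_congr rfl fun j _ => smul_assoc _ _ _

/-- The vectors `x, t x, …, t ^ (d - 1) x`. -/
def powers (x : M) (d : ℕ) (j : Fin d) : M := (X : SkewPolynomial K) ^ (j : ℕ) • x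

/-- Only the remainder of `r` on right division by `a` acts on `x`, and it has degree `< d`. -/
theorem smul_mem_span_powers {a : SkewPolynomial K} {d : ℕ} (ha : IsDegree a d) {x : M}
    (hx : a • x = 0) (r : SkewPolynomial K) :
    r • x ∈ Submodule.span K (Set.range (powers (K := K) x d)) := by
  obtain ⟨q, hq⟩ := exists_division ha r
  have : r • x = (r - q * a) • x := by rw [sub_smul, mul_smul, hx, smul_zero, sub_zero]
  rw [this, smul_eq_sum_of_coeff_eq_zero hq]
  exact Submodule.sum_mem _ fun j _ => Submodule.smul_mem _ _ (Submodule.subset_span ⟨j, rfl⟩)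

theorem span_powers_eq_top {a : SkewPolynomial K} {d : ℕ} (ha : IsDegree a d) {x : M}
    (hx : a • x = 0) (h : ∀ w : M, ∃ r : SkewPolynomial K, r • x = w) :
    ⊤ ≤ Submodule.span K (Set.range (powers (K := K) x d)) := fun w _ => by
  obtain ⟨r, rfl⟩ := h w
  exact smul_mem_span_powers ha hx r

end Cyclic

/-! ### The degree of `K` over `F` -/

section Fixed
variable (K : Type*) [Field K] [MulSemiringAction (Multiplicative ℕ) K]

/-- `σ` as an automorphism of `K`, if it has finite order. -/
def sigmaEquiv (hn : 0 < orderOf (sigma K)) : RingAut K :=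
  RingEquiv.ofRingHom (sigma K) (sigma K ^ (orderOf (sigma K) - 1))
    (by rw [← RingHom.mul_def, ← pow_succ', Nat.sub_add_cancel hn, pow_orderOf_eq_one]; rfl)
    (by rw [← RingHom.mul_def, ← pow_succ, Nat.sub_add_cancel hn, pow_orderOf_eq_one]; rfl)

theorem orderOf_sigmaEquiv (hn : 0 < orderOf (sigma K)) :
    orderOf (sigmaEquiv K hn) = orderOf (sigma K) := by
  let toHom : RingAut K →* (K →+* K) := ⟨⟨fun e => (e : K →+* K), rfl⟩, fun _ _ => rfl⟩
  have hinj : Function.Injective toHom := fun a b h =>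
    RingEquiv.ext fun x => DFunLike.congr_fun (show (a : K →+* K) = b from h) x
  exact (orderOf_injective toHom hinj _).symm

theorem fixedPoints_zpowers_sigmaEquiv (hn : 0 < orderOf (sigma K)) :
    FixedPoints.subfield (Subgroup.zpowers (sigmaEquiv K hn)) K = F K := by
  ext a
  constructor
  · intro h
    exact h ⟨_, Subgroup.mem_zpowers _⟩
  · intro h
    have h1 : sigmaEquiv K hn ∈ MulAction.stabilizer (RingAut K) a := h
    rintro ⟨g, hg⟩
    exact (Subgroup.zpowers_le.2 h1) hg

/-- Artin's theorem for the cyclic group generated by `σ`. -/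
theorem finrank_F (hn : 0 < orderOf (sigma K)) :
    Module.finrank (F K) K = orderOf (sigma K) := by
  have : Finite (Subgroup.zpowers (sigmaEquiv K hn)) := by
    rw [← Nat.card_pos_iff.trans (and_iff_right inferInstance), Nat.card_zpowers,
      orderOf_sigmaEquiv]
    exact hn
  have := Fintype.ofFinite (Subgroup.zpowers (sigmaEquiv K hn))
  rw [← fixedPoints_zpowers_sigmaEquiv K hn, FixedPoints.finrank_eq_card,
    ← Nat.card_eq_fintype_card, Nat.card_zpowers, orderOf_sigmaEquiv]

end Fixed

/-! ### Simplicity of `R/Rf` and irreducibility of `hhat` -/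

namespace V
open SkewPolynomial
variable {K : Type*} [Field K] [MulSemiringAction (Multiplicative ℕ) K]
  {f : SkewPolynomial K} {hhat : Polynomial (F K)} (hh : IsMCLM f hhat)

instance : Module K (V f hhat hh) := Module.compHom _ (CRingHom : K →+* SkewPolynomial K)

instance : IsScalarTower K (SkewPolynomial K) (V f hhat hh) where
  smul_assoc c p v := by
    rw [← C_mul_eq_smul, mul_smul]; rfl

/-- `F` acts on `V_f` both through `E` and through the constants of `R`; the two actions agree, so
dimensions over `F` can be counted either way. -/
instance : IsScalarTower (F K) (AdjoinRoot hhat) (V f hhat hh) where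
  smul_assoc c e v := by
    rw [Algebra.smul_def, mul_smul]
    change central K (Polynomial.C c) • (e • v) = _
    rw [central_C]
    rfl

theorem mk_eq_zero_iff (p : SkewPolynomial K) : mk hh p = 0 ↔ ∃ q, p = q * f := by
  refine (Submodule.Quotient.mk_eq_zero _).trans (Submodule.mem_span_singleton.trans ?_)
  exact exists_congr fun q => eq_comm

theorem smul_mk_one (p : SkewPolynomial K) : p • mk hh 1 = mk hh p := by
  rw [← map_smul, smul_eq_mul, mul_one]

/-- Simplicity of `R/Rf`: from `rg + sf = 1` one gets `p ≡ (pr)g` modulo `Rf`. -/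
theorem exists_smul_eq (hf : Irreducible f) {v : V f hhat hh} (hv : v ≠ 0) (w : V f hhat hh) :
    ∃ r : SkewPolynomial K, r • v = w := by
  obtain ⟨g, rfl⟩ := mk_surjective hh v
  obtain ⟨p, rfl⟩ := mk_surjective hh w
  obtain ⟨r, s, hrs⟩ := mem_span_of_irreducible (g := g) hf fun h =>
    hv ((Submodule.Quotient.mk_eq_zero _).2 h)
  refine ⟨p * r, ?_⟩
  rw [← sub_eq_zero, ← map_smul, ← map_sub, mk_eq_zero_iff]
  refine ⟨- (p * s), ?_⟩
  rw [smul_eq_mul, mul_assoc, eq_sub_of_add_eq hrs]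
  noncomm_ring

theorem smul_mk_one_self : f • mk hh 1 = 0 := by
  rw [smul_mk_one, mk_eq_zero_iff]; exact ⟨1, (one_mul f).symm⟩

/-- A relation would be a nonzero left multiple of `f` of degree less than `m`. -/
theorem linearIndependent_powers {m : ℕ} (hm : IsDegree f m) :
    LinearIndependent K (powers (K := K) (mk hh 1) m) := by
  rw [Fintype.linearIndependent_iff]
  intro c hc
  refine eq_zero_of_ofCoeffs_eq_zero ?_
  have hp0 : mk hh (ofCoeffs c) = 0 := by
    rw [← smul_mk_one, ofCoeffs, Finset.sum_smul, ← hc]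
    exact Finset.sum_congr rfl fun j _ => smul_assoc _ _ _
  obtain ⟨q, hq⟩ := (mk_eq_zero_iff hh _).1 hp0
  by_contra h0
  have hq0 : q ≠ 0 := by rintro rfl; exact h0 (by rw [hq, zero_mul])
  obtain ⟨e, he⟩ := exists_isDegree hq0
  exact (he.mul hm).1 (by rw [← hq]; exact coeff_ofCoeffs_of_le _ (by omega))

/-- The `K`-basis `1, t, …, t ^ (m - 1)` of `R / R f`. -/
def powerBasis {m : ℕ} (hm : IsDegree f m) : Module.Basis (Fin m) K (V f hhat hh) :=
  Module.Basis.mk (linearIndependent_powers hh hm)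
    (span_powers_eq_top hm (smul_mk_one_self hh) fun w => by
      obtain ⟨p, rfl⟩ := mk_surjective hh w
      exact ⟨p, smul_mk_one hh p⟩)

/-- By simplicity `1 = rv`, so the central element also kills `1` and is a left multiple of `f`.
Once made monic it competes with `hhat`. -/
theorem natDegree_le_of_central_smul_eq_zero (hf : Irreducible f) {p : Polynomial (F K)}
    (hp : p ≠ 0) {v : V f hhat hh} (hv : v ≠ 0) (h : central K p • v = 0) :
    hhat.natDegree ≤ p.natDegree := by
  obtain ⟨r, hr⟩ := exists_smul_eq hh hf hv (mk hh 1)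
  have h1 : mk hh (central K p) = 0 := by
    rw [← smul_mk_one, ← hr, ← mul_smul, (central_commute K p r).eq, mul_smul, h, smul_zero]
  obtain ⟨q, hq⟩ := (mk_eq_zero_iff hh _).1 h1
  have hc : p.leadingCoeff⁻¹ ≠ 0 := inv_ne_zero (Polynomial.leadingCoeff_ne_zero.2 hp)
  have hmon : (Polynomial.C p.leadingCoeff⁻¹ * p).Monic := by
    rw [mul_comm]; exact Polynomial.monic_mul_leadingCoeff_inv hp
  have := hh.minimal _ hmon ⟨central K (Polynomial.C p.leadingCoeff⁻¹) * q, by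
    rw [map_mul, hq, mul_assoc]⟩
  rw [Polynomial.degree_C_mul hc] at this
  exact Polynomial.natDegree_le_natDegree this

theorem mk_one_ne_zero {m : ℕ} (hm : IsDegree f m) (h1 : 0 < m) : mk hh 1 ≠ 0 :=
  (linearIndependent_powers hh hm).ne_zero ⟨0, h1⟩ ∘ fun h => by simpa [powers] using h

/-- If `hhat = pq` properly, neither `p(t^n)` nor `q(t^n)` kills a nonzero vector, yet their product
kills `1`. -/
theorem irreducible_hhat (hh : IsMCLM f hhat) (hf : Irreducible f) {m : ℕ} (hm : IsDegree f m) (h1 : 0 < m)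
    (hd : 0 < hhat.natDegree) : Irreducible hhat := by
  have hv := mk_one_ne_zero hh hm h1
  rw [hh.monic.irreducible_iff_natDegree']
  refine ⟨by rintro rfl; simp at hd, fun p q hp hq hpq hq' => ?_⟩
  have key : ∀ p : Polynomial (F K), p.Monic → p.natDegree < hhat.natDegree →
      ∀ v : V f hhat hh, v ≠ 0 → central K p • v ≠ 0 := fun p hp hlt v hv h =>
    absurd (natDegree_le_of_central_smul_eq_zero hh hf hp.ne_zero hv h) (by omega)
  have hdeg : p.natDegree + q.natDegree = hhat.natDegree := by
    rw [← hpq, hp.natDegree_mul hq]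
  rw [Finset.mem_Ioc] at hq'
  refine key p hp (by omega) _ (key q hq (by omega) _ hv) ?_
  rw [← mul_smul, ← map_mul, hpq, central_hhat_smul]

end V

/-! ### Skew polynomials that semi-commute with `K` and commute with `t` -/

section MulX
open SkewPolynomial
variable {K : Type*} [Field K] [MulSemiringAction (Multiplicative ℕ) K]

theorem coeff_mul_X_pow (q : SkewPolynomial K) (r i : ℕ) :
    (q * X ^ r).coeff (i + r) = q.coeff i := by
  induction r with
  | zero => rw [pow_zero, mul_one, add_zero]
  | succ r ih => rw [pow_succ, ← mul_assoc, ← add_assoc, coeff_mul_X_succ, ih]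

theorem coeff_mul_X_pow_of_lt (q : SkewPolynomial K) {r i : ℕ} (h : i < r) :
    (q * X ^ r).coeff i = 0 := by
  induction r generalizing i with
  | zero => omega
  | succ r ih =>
    rw [pow_succ, ← mul_assoc]
    cases i with
    | zero => exact coeff_mul_X_zero _
    | succ i => rw [coeff_mul_X_succ, ih (by omega)]

/-- A skew polynomial `g` that commutes with `t` and semi-commutes with constants is the product
of a central polynomial and a power of `t`. -/
theorem exists_eq_central_mul_X_pow (hn : 0 < orderOf (sigma K)) {g : SkewPolynomial K} {e : ℕ}
    (hg : IsDegree g e) (h1 : ∀ i, sigma K (g.coeff i) = g.coeff i)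
    (h2 : ∀ i a, g.coeff i * (sigma K ^ i) a = (sigma K ^ e) a * g.coeff i) :
    ∃ c : Polynomial (F K), g = central K c * X ^ (e % orderOf (sigma K)) := by
  set n := orderOf (sigma K) with hn'
  -- Where `g_i ≠ 0`, the relation `h2` cancels to `σ^i = σ^e`, so `i ≡ e` modulo `n`.
  have hmod : ∀ i, g.coeff i ≠ 0 → ∃ j ≤ e / n, i = n * j + e % n := by
    intro i hi
    have hie : i ≤ e := by
      by_contra hc
      exact hi (hg.2 i (by omega))
    have hd : n ∣ e - i := by
      refine dvd_of_sigma_pow_eq (i := i) hn (RingHom.ext fun a => ?_)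
      rw [Nat.add_sub_cancel' hie]
      exact mul_left_cancel₀ hi (by rw [h2 i a, mul_comm])
    have hm : i % n = e % n := (Nat.modEq_iff_dvd' hie).2 hd
    exact ⟨i / n, Nat.div_le_div_right hie, by rw [← hm, Nat.div_add_mod]⟩
  let c : Polynomial (F K) := ∑ j ∈ Finset.range (e / n + 1),
    Polynomial.monomial j (⟨g.coeff (n * j + e % n), h1 _⟩ : F K)
  have hc : ∀ j, ((c.coeff j : F K) : K) = g.coeff (n * j + e % n) := by
    intro j
    rw [Polynomial.finsetSum_coeff]
    simp only [Polynomial.coeff_monomial]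
    rw [Finset.sum_ite_eq']
    split_ifs with hj
    · rfl
    · by_contra hne
      obtain ⟨j', hj', he⟩ := hmod _ (Ne.symm hne)
      rw [Nat.add_right_cancel_iff] at he
      have := Nat.eq_of_mul_eq_mul_left hn he
      rw [Finset.mem_range] at hj
      omega
  refine ⟨c, SkewPolynomial.ext fun i => ?_⟩
  rcases lt_or_ge i (e % n) with hi | hi
  · rw [coeff_mul_X_pow_of_lt _ hi]
    by_contra hne
    obtain ⟨j, -, rfl⟩ := hmod i hne
    omega
  · obtain ⟨k, rfl⟩ := Nat.exists_eq_add_of_le' hi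
    rw [coeff_mul_X_pow]
    by_cases hk : n ∣ k
    · obtain ⟨j, rfl⟩ := hk
      rw [coeff_central hn, hc]
    · rw [coeff_central_of_not_dvd _ hk]
      by_contra hne
      obtain ⟨j, -, he⟩ := hmod _ hne
      exact hk ⟨j, by omega⟩

end MulX

/-! ### Annihilators of `V_f`, its dimension and its endomorphisms -/

namespace V
open SkewPolynomial
variable {K : Type*} [Field K] [MulSemiringAction (Multiplicative ℕ) K]
  {f : SkewPolynomial K} {hhat : Polynomial (F K)} (hh : IsMCLM f hhat)

/-- `t^n` acts as the class of `x` in the field `E`, which is nonzero because `deg hhat > 1`; so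
`t^(n-1) x⁻¹` is a right inverse of `t`. -/
theorem X_pow_smul_surjective [Fact (Irreducible hhat)] (hn : 0 < orderOf (sigma K))
    (hd : 1 < hhat.natDegree) (r : ℕ) (w : V f hhat hh) :
    ∃ v : V f hhat hh, (X : SkewPolynomial K) ^ r • v = w := by
  have hX : AdjoinRoot.mk hhat Polynomial.X ≠ 0 := by
    rw [Ne, AdjoinRoot.mk_eq_zero]
    intro h
    have := Polynomial.natDegree_le_of_dvd h Polynomial.X_ne_zero
    rw [Polynomial.natDegree_X] at this
    omega
  induction r with
  | zero => exact ⟨w, by rw [pow_zero, one_smul]⟩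
  | succ r ih =>
    obtain ⟨v, rfl⟩ := ih
    refine ⟨(X : SkewPolynomial K) ^ (orderOf (sigma K) - 1) •
      (AdjoinRoot.mk hhat Polynomial.X)⁻¹ • v, ?_⟩
    rw [← mul_smul, pow_succ, mul_assoc, ← pow_succ', Nat.sub_add_cancel hn, mul_smul,
      ← central_X]
    exact congrArg ((X : SkewPolynomial K) ^ r • ·) (smul_inv_smul₀ hX v)

/-- A nonzero skew polynomial annihilating `V_f` has degree at least `m n`. -/
theorem mul_orderOf_le_of_annihilates [Fact (Irreducible hhat)] (hf : Irreducible f)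
    {m : ℕ} (hm : IsDegree f m) (h1 : 1 < m) (hd : hhat.natDegree = m)
    (hn : 1 < orderOf (sigma K)) {p : SkewPolynomial K} {e : ℕ} (hp : IsDegree p e)
    (h : ∀ v : V f hhat hh, p • v = 0) : m * orderOf (sigma K) ≤ e := by
  obtain ⟨g₀, hg₀I, d, hg₀, hmin⟩ := exists_minimal_isDegree
    (Module.annihilator (SkewPolynomial K) (V f hhat hh)) (Module.mem_annihilator.2 h) hp.ne_zero
  refine le_trans ?_ (hmin p (Module.mem_annihilator.2 h) e hp)
  obtain ⟨g, hg'⟩ : ∃ g : SkewPolynomial K, g = (g₀.coeff d)⁻¹ • g₀ := ⟨_, rfl⟩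
  have hg1 : g.coeff d = 1 := by rw [hg']; exact inv_mul_cancel₀ hg₀.1
  have hg : IsDegree g d := ⟨by rw [hg1]; exact one_ne_zero, fun i hi => by
    rw [hg', coeff_smul', hg₀.2 i hi, mul_zero]⟩
  have hgI : ∀ v : V f hhat hh, g • v = 0 := fun v => by
    rw [hg', smul_assoc, Module.mem_annihilator.1 hg₀I, smul_zero]
  have key : ∀ q : SkewPolynomial K, (∀ v : V f hhat hh, q • v = 0) →
      (∀ i, d ≤ i → q.coeff i = 0) → q = 0 := by
    intro q hq hqd
    by_contra h0
    obtain ⟨e', he', hqe⟩ := exists_isDegree_lt h0 hqd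
    exact absurd (hmin q (Module.mem_annihilator.2 hq) e' hqe) (by omega)
  -- `ga - σ^d(a)g` annihilates `V_f`, and its coefficient of degree `d` vanishes because `g` is
  -- monic; minimality makes it zero.
  have comm1 : ∀ i a, g.coeff i * (sigma K ^ i) a = (sigma K ^ d) a * g.coeff i := by
    intro i a
    have hq : g * C a - C ((sigma K ^ d) a) * g = 0 := by
      refine key _ (fun v => ?_) fun i hi => ?_
      · rw [sub_smul, mul_smul, mul_smul, hgI, hgI, smul_zero, sub_zero]
      · rw [coeff_sub, coeff_mul_C, C_mul_eq_smul, coeff_smul']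
        rcases hi.eq_or_lt with rfl | hi
        · rw [hg1, one_mul, mul_one, sub_self]
        · rw [hg.2 i hi, zero_mul, mul_zero, sub_self]
    have := congrArg (fun q => SkewPolynomial.coeff q i) hq
    simp only [coeff_sub, coeff_mul_C, C_mul_eq_smul, coeff_smul', coeff_zero] at this
    exact sub_eq_zero.1 this
  have hX : ∀ i, (X * g - g * X).coeff (i + 1) = sigma K (g.coeff i) - g.coeff i := by
    intro i
    have := coeff_monomial_mul 1 1 g i
    rw [one_mul, pow_one, add_comm 1 i] at this
    rw [coeff_sub, coeff_mul_X_succ]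
    exact congrArg (· - _) this
  have comm2 : ∀ i, sigma K (g.coeff i) = g.coeff i := by
    intro i
    have hq : X * g - g * X = 0 := by
      refine key _ (fun v => ?_) fun i hi => ?_
      · rw [sub_smul, mul_smul, mul_smul, hgI, hgI, smul_zero, sub_zero]
      · rcases i with - | i
        · rw [coeff_sub, coeff_mul_X_zero, sub_zero]
          exact coeff_monomial_mul_of_lt Nat.zero_lt_one 1 g
        · rw [hX]
          rcases lt_or_eq_of_le hi with hi' | hi'
          · rcases (Nat.lt_succ_iff.1 hi').eq_or_lt with rfl | hi''
            · rw [hg1, map_one, sub_self]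
            · rw [hg.2 i hi'', map_zero, sub_self]
          -- Here `i = d - 1`: the coefficient of `t^d` in `tg - gt` vanishes since `g_(d-1) ≠ 0`
          -- would give `σ^(d-1) = σ^d`, against `n > 1`.
          · have h0 : g.coeff i = 0 := by
              by_contra hne
              have := dvd_of_sigma_pow_eq (K := K) (i := i) (k := 1) (by omega)
                (RingHom.ext fun a => mul_left_cancel₀ hne (by
                  rw [comm1 i a, hi', mul_comm]))
              have := Nat.le_of_dvd one_pos this
              omega
            rw [h0, map_zero, sub_self]
    have := hX i
    rw [hq, coeff_zero] at this
    exact sub_eq_zero.1 this.symm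
  obtain ⟨c, hc⟩ := exists_eq_central_mul_X_pow (by omega) hg comm2 comm1
  have hc0 : c ≠ 0 := by
    rintro rfl
    rw [map_zero, zero_mul] at hc
    exact hg.ne_zero hc
  have hcm : m ≤ c.natDegree := by
    rw [← hd]
    -- Choose `v` with `t^r v = 1`; then `c(t^n)` kills `1`, because `gv = 0`.
    obtain ⟨v, hv⟩ := X_pow_smul_surjective hh (by omega) (by omega)
      (d % orderOf (sigma K)) (mk hh 1)
    refine natDegree_le_of_central_smul_eq_zero hh hf hc0 (mk_one_ne_zero hh hm (by omega)) ?_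
    rw [← hv, ← mul_smul, ← hc, hgI]
  have hXd : IsDegree ((X : SkewPolynomial K) ^ (d % orderOf (sigma K)))
      (d % orderOf (sigma K)) := by
    rw [X_pow_eq_monomial]
    exact ⟨by rw [coeff_monomial, if_pos rfl]; exact one_ne_zero,
      fun i hi => by rw [coeff_monomial, if_neg hi.ne]⟩
  have hdeg := (isDegree_central (by omega) hc0).mul hXd
  rw [← hc] at hdeg
  rw [hg.unique hdeg, mul_comm m]
  exact (Nat.mul_le_mul_left _ hcm).trans (Nat.le_add_right _ _)

section Dimension
variable {m : ℕ}

theorem finite_F (hn : 1 < orderOf (sigma K)) : Module.Finite (F K) K :=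
  Module.finite_of_finrank_pos (by rw [finrank_F K (by omega)]; omega)

theorem finite_F_V (hm : IsDegree f m) (hn : 1 < orderOf (sigma K)) :
    Module.Finite (F K) (V f hhat hh) :=
  have := finite_F hn
  have := Module.Finite.of_basis (powerBasis hh hm)
  Module.Finite.trans K _

variable [Fact (Irreducible hhat)]

theorem finite_E_V (hm : IsDegree f m) (hn : 1 < orderOf (sigma K)) :
    Module.Finite (AdjoinRoot hhat) (V f hhat hh) :=
  have := finite_F_V hh hm hn
  Module.Finite.of_restrictScalars_finite (F K) _ _

theorem finrank_F_E (hd : hhat.natDegree = m) :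
    Module.finrank (F K) (AdjoinRoot hhat) = m :=
  (finrank_quotient_span_eq_natDegree (f := hhat)).trans hd

theorem finrank_E_V (hm : IsDegree f m) (h1 : 1 < m) (hd : hhat.natDegree = m)
    (hn : 1 < orderOf (sigma K)) :
    Module.finrank (AdjoinRoot hhat) (V f hhat hh) = orderOf (sigma K) := by
  have e1 := Module.finrank_mul_finrank (F K) (AdjoinRoot hhat) (V f hhat hh)
  have e2 := Module.finrank_mul_finrank (F K) K (V f hhat hh)
  rw [finrank_F_E hd] at e1
  rw [finrank_F K (by omega), Module.finrank_eq_card_basis (powerBasis hh hm), Fintype.card_fin,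
    ← e1, mul_comm] at e2
  exact (Nat.eq_of_mul_eq_mul_left (by omega) e2).symm

/-- `c ↦ L_a`, where `a = ∑ c_j t ^ j`. -/
def endOfCoeffs (d : ℕ) : (Fin d → K) →ₗ[F K]
    (V f hhat hh →ₗ[AdjoinRoot hhat] V f hhat hh) where
  toFun c := ofCoeffs c • LinearMap.id
  map_add' c c' := by
    rw [← add_smul, ofCoeffs, ofCoeffs, ofCoeffs, ← Finset.sum_add_distrib]
    simp only [Pi.add_apply, add_smul]
  map_smul' a c := by
    have : ofCoeffs (a • c) = (a : K) • ofCoeffs c := by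
      rw [ofCoeffs, ofCoeffs, Finset.smul_sum]
      exact Finset.sum_congr rfl fun j _ => mul_smul _ _ _
    rw [this]
    ext v
    exact smul_assoc (a : K) (ofCoeffs c) v

/-- Every `E`-endomorphism of `V_f` is the left multiplication by some skew polynomial. -/
theorem exists_smul_eq_end (hf : Irreducible f) (hm : IsDegree f m) (h1 : 1 < m)
    (hd : hhat.natDegree = m) (hn : 1 < orderOf (sigma K))
    (P : V f hhat hh →ₗ[AdjoinRoot hhat] V f hhat hh) :
    ∃ p : SkewPolynomial K, ∀ v, p • v = P v := by
  have := finite_F (K := K) hn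
  have := finite_F_V hh hm hn
  have := finite_E_V hh hm hn
  have : Module.Finite (F K) (AdjoinRoot hhat) := hh.monic.finite_adjoinRoot
  have : Module.Finite (F K) (V f hhat hh →ₗ[AdjoinRoot hhat] V f hhat hh) :=
    Module.Finite.trans (AdjoinRoot hhat) _
  -- Both dimensions are `mn²`: `mn·[K:F]` on one side, `n²·[E:F]` on the other.
  have hrank : Module.finrank (F K) (Fin (m * orderOf (sigma K)) → K) =
      Module.finrank (F K) (V f hhat hh →ₗ[AdjoinRoot hhat] V f hhat hh) := by
    rw [← Module.finrank_mul_finrank (F K) (AdjoinRoot hhat)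
        (V f hhat hh →ₗ[AdjoinRoot hhat] V f hhat hh), Module.finrank_linearMap,
      finrank_E_V hh hm h1 hd hn, finrank_F_E hd,
      ← Module.finrank_mul_finrank (F K) K (Fin (m * orderOf (sigma K)) → K),
      Module.finrank_fin_fun, finrank_F K (by omega)]
    ring
  have hinj : Function.Injective (endOfCoeffs hh (m * orderOf (sigma K))) := by
    rw [← LinearMap.ker_eq_bot, LinearMap.ker_eq_bot']
    intro c hc
    funext i
    refine eq_zero_of_ofCoeffs_eq_zero ?_ i
    by_contra h0
    obtain ⟨e, he, hpe⟩ := exists_isDegree_lt h0 fun i hi => coeff_ofCoeffs_of_le c hi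
    exact absurd (mul_orderOf_le_of_annihilates hh hf hm h1 hd hn hpe
      fun v => DFunLike.congr_fun hc v) (by omega)
  obtain ⟨c, hc⟩ := (LinearMap.injective_iff_surjective_of_finrank_eq_finrank hrank).1 hinj P
  exact ⟨_, fun v => DFunLike.congr_fun hc v⟩

/-- If `g` is not in the `E`-line of `1`, some `E`-endomorphism kills `1` but not `g`. It is left
multiplication by some `a`; killing `1` means `a = bf`, and then `ag = b(fg)` lies in `Rf`, a
contradiction. -/
theorem rightNucleus_eq (hf : Irreducible f) (hm : IsDegree f m) (h1 : 1 < m)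
    (hd : hhat.natDegree = m) (hn : 1 < orderOf (sigma K)) :
    rightNucleus hh = Set.range (fun p : Polynomial (F K) => mk hh (central K p)) := by
  ext w
  constructor
  · rintro ⟨g, ⟨q, hq⟩, rfl⟩
    by_contra hw
    have hli : mk hh g ∉ Submodule.span (AdjoinRoot hhat) {mk hh 1} := by
      rw [Submodule.mem_span_singleton]
      rintro ⟨e, he⟩
      obtain ⟨p, rfl⟩ := AdjoinRoot.mk_surjective e
      exact hw ⟨p, by rw [smul_mk, one_mul] at he; exact he⟩
    obtain ⟨φ, hφ, hφ0⟩ := Submodule.exists_le_ker_of_notMem hli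
    obtain ⟨a, ha⟩ := exists_smul_eq_end hh hf hm h1 hd hn (φ.smulRight (mk hh 1))
    have ha1 : mk hh a = 0 := by
      rw [← smul_mk_one, ha, LinearMap.smulRight_apply,
        LinearMap.mem_ker.1 (hφ0 (Submodule.mem_span_singleton_self _)), zero_smul]
    obtain ⟨b, rfl⟩ := (mk_eq_zero_iff hh a).1 ha1
    have : (φ.smulRight (mk hh 1)) (mk hh g) = 0 := by
      rw [← ha, ← map_smul, mk_eq_zero_iff]
      exact ⟨b * q, by rw [smul_eq_mul, mul_assoc, hq, mul_assoc]⟩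
    rw [LinearMap.smulRight_apply] at this
    exact (smul_ne_zero hφ (mk_one_ne_zero hh hm (by omega))) this
  · rintro ⟨p, rfl⟩
    exact ⟨_, ⟨_, (central_commute K p f).eq.symm⟩, rfl⟩

end Dimension

end V

/-! ### Matrices of the semilinear map `v ↦ tv` and their determinants -/

section ActionMatrix
open SkewPolynomial Matrix
variable {K : Type*} [Field K] [MulSemiringAction (Multiplicative ℕ) K]
  {M : Type*} [AddCommGroup M] [Module K M] [Module (SkewPolynomial K) M]
  {ι ι' : Type*}

/-- The matrix of the semilinear map `v ↦ t v`. -/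
def actionMatrix (b : Module.Basis ι K M) : Matrix ι ι K :=
  Matrix.of fun i j => b.repr ((X : SkewPolynomial K) • b j) i

theorem actionMatrix_reindex (b : Module.Basis ι K M) (e : ι ≃ ι') :
    actionMatrix (b.reindex e) = (actionMatrix b).submatrix e.symm e.symm := by
  ext i j
  simp [actionMatrix]

/-- Since `t(cv) = σ(c)tv`, change of basis is `σ`-twisted conjugation; it alters the determinant by
a factor `σ(δ)/δ`. -/
theorem actionMatrix_mul [Fintype ι] [DecidableEq ι] [IsScalarTower K (SkewPolynomial K) M]
    (b c : Module.Basis ι K M) :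
    b.toMatrix c * actionMatrix c = actionMatrix b * (b.toMatrix c).map (sigma K) := by
  ext i j
  have h1 : (X : SkewPolynomial K) • c j = ∑ k, c.repr ((X : SkewPolynomial K) • c j) k • c k :=
    (c.sum_repr _).symm
  have h2 : (X : SkewPolynomial K) • c j =
      ∑ k, sigma K (b.repr (c j) k) • (X : SkewPolynomial K) • b k := by
    conv_lhs => rw [← b.sum_repr (c j)]
    rw [Finset.smul_sum]
    exact Finset.sum_congr rfl fun k _ => X_smul_smul _ _
  have h := congrArg (fun v => b.repr v i) (h1.symm.trans h2)
  simp only [map_sum, map_smul, Finsupp.coe_finsetSum, Finset.sum_apply, Finsupp.smul_apply,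
    smul_eq_mul] at h
  rw [Matrix.mul_apply, Matrix.mul_apply]
  refine Eq.trans ?_ (h.trans ?_)
  · exact Finset.sum_congr rfl fun k _ => mul_comm _ _
  · exact Finset.sum_congr rfl fun k _ => mul_comm _ _

/-- The norm of the determinant of `v ↦ t v` does not depend on the basis. -/
theorem norm_det_actionMatrix_eq [Fintype ι] [DecidableEq ι] [Fintype ι'] [DecidableEq ι']
    [IsScalarTower K (SkewPolynomial K) M]
    {k : Type*} [Field k] [Algebra k K] [FiniteDimensional k K]
    (hσ : ∀ a : K, Algebra.norm k (sigma K a) = Algebra.norm k a)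
    (b : Module.Basis ι K M) (c : Module.Basis ι' K M) :
    Algebra.norm k (actionMatrix b).det = Algebra.norm k (actionMatrix c).det := by
  let e := c.indexEquiv b
  have hc : (actionMatrix (c.reindex e)).det = (actionMatrix c).det := by
    rw [actionMatrix_reindex, Matrix.det_submatrix_equiv_self]
  rw [← hc]
  have h := congrArg (fun A => Algebra.norm k A.det) (actionMatrix_mul b (c.reindex e))
  have hdet : ((b.toMatrix (c.reindex e)).map (sigma K)).det =
      sigma K (b.toMatrix (c.reindex e)).det := (RingHom.map_det _ _).symm
  simp only [Matrix.det_mul, map_mul, hdet, hσ] at h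
  rw [mul_comm] at h
  refine (mul_right_cancel₀ (Algebra.norm_ne_zero_iff.2 ?_) h).symm
  exact (b.isUnit_det (c.reindex e)).ne_zero

/-- In row `0` only the last entry can be nonzero, and its minor is the identity. -/
theorem det_companion {R : Type*} [CommRing R] {d : ℕ} (g : Fin (d + 1) → R)
    {A : Matrix (Fin (d + 1)) (Fin (d + 1)) R} (h1 : ∀ i, A i (Fin.last d) = - g i)
    (h2 : ∀ i (j : Fin d), A i j.castSucc = if i = j.succ then 1 else 0) :
    A.det = (-1) ^ (d + 1) * g 0 := by
  rw [Matrix.det_succ_row_zero, Fin.sum_univ_castSucc]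
  have hA : A.submatrix Fin.succ (Fin.last d).succAbove = 1 := by
    ext i j
    rw [Matrix.submatrix_apply, Fin.succAbove_last, h2, Matrix.one_apply]
    simp only [Fin.succ_inj]
  rw [Finset.sum_eq_zero fun j _ => by
    rw [h2, if_neg (Fin.succ_ne_zero j).symm, mul_zero, zero_mul], hA, h1, Matrix.det_one]
  simp [pow_succ]

/-- The relation `ax = 0` expresses `t^(d+1) x` in the basis, so the matrix is the companion matrix
of `a` divided by its leading coefficient. -/
theorem det_actionMatrix_powers [IsScalarTower K (SkewPolynomial K) M] {a : SkewPolynomial K}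
    {d : ℕ} (ha : IsDegree a (d + 1)) {x : M} (hx : a • x = 0)
    (b : Module.Basis (Fin (d + 1)) K M) (hb : ⇑b = powers (K := K) x (d + 1)) :
    (actionMatrix b).det = (-1) ^ (d + 1) * (a.coeff 0 / a.coeff (d + 1)) := by
  have hX : ∀ j : Fin (d + 1), (X : SkewPolynomial K) • b j =
      (X : SkewPolynomial K) ^ ((j : ℕ) + 1) • x := fun j => by
    rw [hb, powers, ← mul_smul, pow_succ']
  refine det_companion (fun j => a.coeff j / a.coeff (d + 1)) (fun i => ?_) fun i j => ?_
  · have h : (X : SkewPolynomial K) • b (Fin.last d) =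
        ∑ j : Fin (d + 1), (-(a.coeff j / a.coeff (d + 1))) • b j := by
      rw [hX, Fin.val_last]
      have h0 := smul_eq_sum_of_coeff_eq_zero (d := d + 2) (fun i hi => ha.2 i (by omega)) x
      rw [hx, Fin.sum_univ_castSucc] at h0
      have h3 := congrArg (fun v => (a.coeff (d + 1))⁻¹ • v) (eq_neg_of_add_eq_zero_right h0.symm)
      simp only [Fin.val_last, Fin.val_castSucc, inv_smul_smul₀ ha.1] at h3
      rw [h3, smul_neg, Finset.smul_sum, ← Finset.sum_neg_distrib]
      refine Finset.sum_congr rfl fun j _ => ?_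
      rw [← mul_smul, ← neg_smul, hb, powers, div_eq_inv_mul]
    rw [actionMatrix, Matrix.of_apply, h]
    simp [Finsupp.single_apply]
  · have h : (X : SkewPolynomial K) • b j.castSucc = b j.succ := by
      rw [hX, hb, powers, Fin.val_succ, Fin.val_castSucc]
    rw [actionMatrix, Matrix.of_apply, h, Module.Basis.repr_self, Finsupp.single_apply]
    simp only [eq_comm]

theorem det_actionMatrix_pi [Fintype ι] [DecidableEq ι] (b : Module.Basis ι K M) (l : ℕ) :
    (actionMatrix ((Pi.basis fun _ : Fin l => b).reindex
      ((Equiv.sigmaEquivProd (Fin l) ι).trans (Equiv.prodComm _ _)))).det =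
      (actionMatrix b).det ^ l := by
  have h : actionMatrix ((Pi.basis fun _ : Fin l => b).reindex
      ((Equiv.sigmaEquivProd (Fin l) ι).trans (Equiv.prodComm _ _))) =
      Matrix.blockDiagonal fun _ : Fin l => actionMatrix b := by
    ext ⟨i, k⟩ ⟨j, k'⟩
    rw [Matrix.blockDiagonal_apply, actionMatrix_reindex]
    simp only [actionMatrix, Matrix.submatrix_apply, Matrix.of_apply, Pi.basis_repr,
      Equiv.symm_trans_apply, Equiv.prodComm_symm, Equiv.prodComm_apply, Prod.swap_prod_mk,
      Equiv.sigmaEquivProd_symm_apply, Pi.basis_apply, Pi.smul_apply]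
    by_cases hk : k = k'
    · subst hk; simp
    · simp [hk]
  rw [h, Matrix.det_blockDiagonal, Finset.prod_const, Finset.card_univ, Fintype.card_fin]

end ActionMatrix

/-! ### Zeros of a skew polynomial in `V_f` -/

namespace V
open SkewPolynomial
variable {K : Type*} [Field K] [MulSemiringAction (Multiplicative ℕ) K]
  {f : SkewPolynomial K} {hhat : Polynomial (F K)} (hh : IsMCLM f hhat)
  [Fact (Irreducible hhat)] {m : ℕ}

/-- The linearly independent zeros of a skew polynomial of degree `e` in `V_f` number at most
`e / m`; in case of equality the norms of the constant coefficients are related. -/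
theorem le_isDegree_of_linearIndependent (hf : Irreducible f) (hm : IsDegree f m) (h1 : 1 < m)
    (hmonic : f.coeff m = 1) (hd : hhat.natDegree = m) (hn : 1 < orderOf (sigma K))
    {k : Type*} [Field k] [Algebra k K] [FiniteDimensional k K]
    (hσ : ∀ a : K, Algebra.norm k (sigma K a) = Algebra.norm k a)
    {a : SkewPolynomial K} {e l : ℕ} (ha : IsDegree a e)
    {x : Fin l → V f hhat hh} (hx : LinearIndependent (AdjoinRoot hhat) x)
    (hax : ∀ i, a • x i = 0) (hl : 0 < l) :
    l * m ≤ e ∧ (e = l * m →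
      Algebra.norm k (a.coeff 0 / a.coeff e) = Algebra.norm k (f.coeff 0) ^ l) := by
  have hax' : a • x = 0 := funext hax
  -- An `E`-endomorphism can send the independent `x_i` to any `w_i`, and it comes from `R`; so `x`
  -- generates `V_f^l`.
  have hsurj : ∀ w : Fin l → V f hhat hh, ∃ r : SkewPolynomial K, r • x = w := fun w => by
    obtain ⟨P, hP⟩ : ∃ P : V f hhat hh →ₗ[AdjoinRoot hhat] V f hhat hh, ∀ i, P (x i) = w i := by
      obtain ⟨P, hP⟩ := ((Module.Basis.span hx).constr ℕ w).exists_extend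
      refine ⟨P, fun i => ?_⟩
      have h := DFunLike.congr_fun hP (Module.Basis.span hx i)
      rwa [Module.Basis.constr_basis, LinearMap.comp_apply, Submodule.subtype_apply,
        Module.Basis.span_apply] at h
    obtain ⟨r, hr⟩ := exists_smul_eq_end hh hf hm h1 hd hn P
    exact ⟨r, funext fun i => (hr _).trans (hP i)⟩
  have hspan := span_powers_eq_top ha hax' hsurj
  let B₂ := (Pi.basis fun _ : Fin l => powerBasis hh hm).reindex
    ((Equiv.sigmaEquivProd (Fin l) (Fin m)).trans (Equiv.prodComm _ _))
  have hfr : Module.finrank K (Fin l → V f hhat hh) = l * m := by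
    rw [Module.finrank_eq_card_basis B₂, Fintype.card_prod, Fintype.card_fin, Fintype.card_fin,
      mul_comm]
  refine ⟨?_, ?_⟩
  · rw [← hfr, ← finrank_top]
    have h := finrank_range_le_card (R := K) (powers (K := K) x e)
    rwa [Set.finrank, top_le_iff.1 hspan, Fintype.card_fin] at h
  · intro he
    let B₁ := basisOfTopLeSpanOfCardEqFinrank (powers (K := K) x e) hspan
      (by rw [Fintype.card_fin, hfr, he])
    have hB₁ : ⇑B₁ = powers (K := K) x e := coe_basisOfTopLeSpanOfCardEqFinrank _ _ _
    have hpow : ⇑(powerBasis hh hm) = powers (K := K) (mk hh 1) m := Module.Basis.coe_mk _ _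
    -- `B₁` gives the companion matrix of `a`, `B₂` gives `l` blocks for `f`; the signs `(-1)^(lm)`
    -- agree and cancel.
    have key := norm_det_actionMatrix_eq hσ B₁ B₂
    obtain ⟨m, rfl⟩ := Nat.exists_eq_succ_of_ne_zero (show m ≠ 0 by omega)
    have he0 : 0 < e := by rw [he]; positivity
    obtain ⟨e, rfl⟩ := Nat.exists_eq_succ_of_ne_zero he0.ne'
    rw [det_actionMatrix_powers ha hax' B₁ hB₁, det_actionMatrix_pi,
      det_actionMatrix_powers hm (smul_mk_one_self hh) _ hpow, hmonic, div_one, mul_pow,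
      ← pow_mul, mul_comm (m + 1) l, ← Nat.succ_eq_add_one, ← Nat.succ_eq_add_one, he, map_mul,
      map_mul] at key
    have hne : Algebra.norm k ((-1 : K) ^ (l * m.succ)) ≠ 0 :=
      Algebra.norm_ne_zero_iff.2 (pow_ne_zero _ (neg_ne_zero.2 one_ne_zero))
    rw [he, mul_left_cancel₀ hne key, map_pow]

end V

/-! ### Rank bounds for matrix codes -/

section RankDistance
variable {E : Type*} [Field E] {n : ℕ}

theorem rank_le_of_forall_lt_eq_zero (M : Matrix (Fin n) (Fin n) E) {r : ℕ} (hr : r ≤ n)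
    (h : ∀ i (j : Fin r), M i (Fin.castLE hr j) = 0) : M.rank ≤ n - r := by
  let w : Fin n → E := fun j => if (j : ℕ) < r then 0 else 1
  have hM : M = M * Matrix.diagonal w := by
    ext i j
    rw [Matrix.mul_diagonal]
    by_cases hj : (j : ℕ) < r
    · have := h i ⟨j, hj⟩
      simp only [w, if_pos hj, mul_zero]
      exact this
    · simp [w, hj]
  rw [hM]
  refine (Matrix.rank_mul_le_right _ _).trans ?_
  classical
  rw [Matrix.rank_diagonal, Fintype.card_subtype]
  have hset : (Finset.univ.filter fun j => w j ≠ 0) ⊆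
      (Finset.univ.image (Fin.castLE hr))ᶜ := by
    intro j hj
    simp only [Finset.mem_compl, Finset.mem_image, Finset.mem_univ, true_and, not_exists]
    rintro i rfl
    simp only [w, Finset.mem_filter, Fin.val_castLE, if_pos i.2] at hj
    exact hj.2 rfl
  refine (Finset.card_le_card hset).trans ?_
  rw [Finset.card_compl, Finset.card_image_of_injective _ (Fin.castLE_injective hr)]
  simp

/-- A linear code of dimension more than `n r [E : k]` has a nonzero element of rank at most
`n - r`. -/
theorem exists_rank_le {k : Type*} [Field k] [Algebra k E] [FiniteDimensional k E]
    (W : Submodule k (Matrix (Fin n) (Fin n) E)) {r : ℕ} (hr : r ≤ n)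
    (hW : n * r * Module.finrank k E < Module.finrank k W) :
    ∃ M ∈ W, M ≠ 0 ∧ M.rank ≤ n - r := by
  -- `T` keeps the first `r` columns; its target has dimension `nr[E:k]`, too small for `T` to be
  -- injective on `W`.
  let T : Matrix (Fin n) (Fin n) E →ₗ[k] (Fin n → Fin r → E) :=
    { toFun := fun M i j => M i (Fin.castLE hr j)
      map_add' := fun _ _ => rfl
      map_smul' := fun _ _ => rfl }
  have hker : LinearMap.ker (T.domRestrict W) ≠ ⊥ := by
    refine LinearMap.ker_ne_bot_of_finrank_lt ?_
    simpa [Module.finrank_pi_fintype, mul_assoc] using hW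
  obtain ⟨M, hM, hM0⟩ := Submodule.exists_mem_ne_zero_of_ne_bot hker
  refine ⟨M, M.2, fun h => hM0 (Subtype.ext h), rank_le_of_forall_lt_eq_zero _ hr fun i j => ?_⟩
  exact congrFun (congrFun (LinearMap.mem_ker.1 hM) i) j

theorem finrank_lt_rank_toMatrix {V' : Type*} [AddCommGroup V'] [Module E V']
    (b : Module.Basis (Fin n) E V') (φ : V' →ₗ[E] V') {l : ℕ}
    (h : Module.finrank E (LinearMap.ker φ) < l) (hl : l ≤ n) :
    n - l + 1 ≤ (LinearMap.toMatrix b b φ).rank := by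
  have := Module.Finite.of_basis b
  have h1 := φ.finrank_range_add_finrank_ker
  rw [Module.finrank_eq_card_basis b, Fintype.card_fin] at h1
  rw [Matrix.rank_eq_finrank_range_toLin _ b b, Matrix.toLin_toMatrix]
  omega

end RankDistance

/-! ### Invariance of the norm under `ρ` and `σ` -/

section Norm
variable {K : Type*} [Field K] {k : Type*} [Field k] [Algebra k K]

theorem norm_ringEquiv {ρ : K ≃+* K} (hρ : ∀ r : k, ρ (algebraMap k K r) = algebraMap k K r)
    (a : K) : Algebra.norm k (ρ a) = Algebra.norm k a :=
  Algebra.norm_eq_of_algEquiv (AlgEquiv.ofRingEquiv (R := k) (f := ρ) hρ) a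

theorem norm_sigma [MulSemiringAction (Multiplicative ℕ) K]
    [Algebra k (F K)] [IsScalarTower k (F K) K] (hn : 0 < orderOf (sigma K))
    (a : K) : Algebra.norm k (sigma K a) = Algebra.norm k a :=
  Algebra.norm_eq_of_algEquiv (AlgEquiv.ofRingEquiv (R := k) (f := sigmaEquiv K hn) fun r => by
    rw [IsScalarTower.algebraMap_apply k (F K) K]
    exact sigma_coe K (algebraMap k (F K) r)) a

end Norm

/-! ### The twisted code and its parameters -/

section Code
open SkewPolynomial
variable {K : Type*} [Field K] [MulSemiringAction (Multiplicative ℕ) K]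

/-- The element `d_0 + d_1 t + ⋯ + d_{N-1} t ^ (N-1) + ν ρ(d_0) t ^ N`. -/
def twisted (ν : K) (ρ : K ≃+* K) {N : ℕ} (hN : 0 < N) (c : Fin N → K) : SkewPolynomial K :=
  ofCoeffs c + monomial N (ν * ρ (c ⟨0, hN⟩))

theorem mem_A_iff (ν : K) (ρ : K ≃+* K) {N : ℕ} (hN : 0 < N) (a : SkewPolynomial K) :
    a ∈ A ν ρ N ↔ ∃ c : Fin N → K, twisted ν ρ hN c = a := by
  have hsum : ∀ d : ℕ → K, ∑ i ∈ Finset.range N, monomial i (d i) =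
      ofCoeffs fun j : Fin N => d j := fun d => by
    rw [ofCoeffs, ← Fin.sum_univ_eq_sum_range (fun i => (monomial i (d i) : SkewPolynomial K))]
    refine Finset.sum_congr rfl fun j _ => ?_
    rw [X_pow_eq_monomial, ← map_smul, smul_eq_mul, mul_one]
  constructor
  · rintro ⟨d, rfl⟩
    exact ⟨fun j => d j, by rw [twisted, hsum]⟩
  · rintro ⟨c, rfl⟩
    refine ⟨fun i => if h : i < N then c ⟨i, h⟩ else 0, ?_⟩
    rw [hsum, twisted]
    simp [hN]

theorem coeff_twisted_of_lt (ν : K) (ρ : K ≃+* K) {N : ℕ} (hN : 0 < N) (c : Fin N → K)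
    (i : Fin N) : (twisted ν ρ hN c).coeff i = c i := by
  rw [twisted, coeff_add, coeff_ofCoeffs, coeff_monomial, if_neg (by omega), add_zero]
  simp [Fin.val_inj]

theorem coeff_twisted_self (ν : K) (ρ : K ≃+* K) {N : ℕ} (hN : 0 < N) (c : Fin N → K) :
    (twisted ν ρ hN c).coeff N = ν * ρ (c ⟨0, hN⟩) := by
  rw [twisted, coeff_add, coeff_ofCoeffs_of_le _ le_rfl, coeff_monomial, if_pos rfl, zero_add]

theorem coeff_twisted_of_gt (ν : K) (ρ : K ≃+* K) {N : ℕ} (hN : 0 < N) (c : Fin N → K) {i : ℕ}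
    (hi : N < i) : (twisted ν ρ hN c).coeff i = 0 := by
  rw [twisted, coeff_add, coeff_ofCoeffs_of_le _ hi.le, coeff_monomial, if_neg hi.ne, zero_add]

variable {f : SkewPolynomial K} {hhat : Polynomial (F K)} (hh : IsMCLM f hhat)

variable {k : Type*} [Field k] [Algebra k K] [Algebra k (F K)] [IsScalarTower k (F K) K]

/-- A kernel of dimension at least `l` forces degree exactly `lm`, hence `d_0 ≠ 0`, and the norm
relation becomes `N(f_0)^l N(ν) = 1` because `N(ρ(d_0)) = N(d_0)`. -/
theorem finrank_ker_L_lt [Fact (Irreducible hhat)] (hf : Irreducible f) {m l : ℕ}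
    (hm : IsDegree f m) (h1 : 1 < m) (hmonic : f.coeff m = 1) (hd : hhat.natDegree = m)
    (hn : 1 < orderOf (sigma K)) (ν : K) (ρ : K ≃+* K)
    [FiniteDimensional k (F K)] (hρ : ∀ r : k, ρ (algebraMap k K r) = algebraMap k K r)
    (hν : Algebra.norm k ν ≠ 1 / Algebra.norm k (f.coeff 0) ^ l)
    (hl : 0 < l) (hN : 0 < l * m) {c : Fin (l * m) → K} (hc : twisted ν ρ hN c ≠ 0) :
    Module.finrank (AdjoinRoot hhat)
      (LinearMap.ker (L hh (Submodule.Quotient.mk (twisted ν ρ hN c)))) < l := by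
  have := V.finite_F (K := K) hn
  have : FiniteDimensional k K := Module.Finite.trans (F K) K
  have := V.finite_E_V hh hm hn
  by_contra! hle
  obtain ⟨x, hx⟩ := exists_linearIndependent_of_le_finrank hle
  obtain ⟨e, he⟩ := exists_isDegree hc
  have hxV : LinearIndependent (AdjoinRoot hhat) fun i => (x i : V f hhat hh) :=
    hx.map' (Submodule.subtype _) (Submodule.ker_subtype _)
  obtain ⟨h2, h3⟩ := V.le_isDegree_of_linearIndependent hh hf hm h1 hmonic hd hn
    (norm_sigma (k := k) (by omega)) he hxV (fun i => LinearMap.mem_ker.1 (x i).2) hl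
  have hee : e = l * m := by
    refine le_antisymm ?_ h2
    by_contra! hlt
    exact he.1 (coeff_twisted_of_gt ν ρ hN c hlt)
  subst hee
  have h4 := h3 rfl
  have hne := he.1
  have h0 : (twisted ν ρ hN c).coeff 0 = c ⟨0, hN⟩ := coeff_twisted_of_lt ν ρ hN c ⟨0, hN⟩
  rw [coeff_twisted_self] at h4 hne
  rw [h0] at h4
  have hc0 : c ⟨0, hN⟩ ≠ 0 := fun h => hne (by rw [h, map_zero, mul_zero])
  have hcn : Algebra.norm k (c ⟨0, hN⟩) ≠ 0 := Algebra.norm_ne_zero_iff.2 hc0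
  apply hν
  have h5 := congrArg (Algebra.norm k) (div_mul_cancel₀ (c ⟨0, hN⟩) hne)
  rw [map_mul, h4, map_mul, norm_ringEquiv hρ, ← mul_assoc] at h5
  exact eq_one_div_of_mul_eq_one_right (mul_right_cancel₀ hcn (h5.trans (one_mul _).symm))

variable {n : ℕ} (b : Module.Basis (Fin n) (AdjoinRoot hhat) (V f hhat hh))

/-- The linear parametrization of the code. -/
def codeMap (ν : K) {ρ : K ≃+* K}
    (hρ : ∀ r : k, ρ (algebraMap k K r) = algebraMap k K r) {N : ℕ} (hN : 0 < N) :
    (Fin N → K) →ₗ[k] Matrix (Fin n) (Fin n) (AdjoinRoot hhat) where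
  toFun c := LinearMap.toMatrix b b (L hh (Submodule.Quotient.mk (twisted ν ρ hN c)))
  map_add' c c' := by
    have : twisted ν ρ hN (c + c') = twisted ν ρ hN c + twisted ν ρ hN c' := by
      rw [twisted, twisted, twisted, Pi.add_apply, map_add, mul_add, map_add, ofCoeffs, ofCoeffs,
        ofCoeffs]
      simp only [Pi.add_apply, add_smul, Finset.sum_add_distrib]
      abel
    rw [this, Submodule.Quotient.mk_add, map_add, map_add]
  map_smul' a c := by
    have h : twisted ν ρ hN (a • c) = algebraMap k K a • twisted ν ρ hN c := by
      have h0 : ρ ((a • c) ⟨0, hN⟩) = algebraMap k K a * ρ (c ⟨0, hN⟩) := by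
        rw [Pi.smul_apply, Algebra.smul_def, map_mul, hρ]
      rw [twisted, twisted, h0, mul_left_comm, ← smul_eq_mul (a := algebraMap k K a), map_smul,
        smul_add, ofCoeffs, ofCoeffs, Finset.smul_sum]
      congr 1
      refine Finset.sum_congr rfl fun j _ => ?_
      rw [Pi.smul_apply, Algebra.smul_def, mul_smul]
    -- Constants from `k` are central in `R`, so multiplying by them on the left is scalar
    -- multiplication through `E`.
    have h' : L hh (Submodule.Quotient.mk (twisted ν ρ hN (a • c))) =
        algebraMap k (AdjoinRoot hhat) a •
          L hh (Submodule.Quotient.mk (twisted ν ρ hN c)) := by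
      ext v
      rw [h, LinearMap.smul_apply, IsScalarTower.algebraMap_apply k (F K) K,
        IsScalarTower.algebraMap_apply k (F K) (AdjoinRoot hhat)]
      refine Eq.trans ?_ (algebraMap_smul (AdjoinRoot hhat) (algebraMap k (F K) a) _).symm
      exact smul_assoc ((algebraMap k (F K) a : F K) : K) (twisted ν ρ hN c) v
    rw [h', map_smul, algebraMap_smul, RingHom.id_apply]

theorem range_codeMap (ν : K) {ρ : K ≃+* K}
    (hρ : ∀ r : k, ρ (algebraMap k K r) = algebraMap k K r) {m l : ℕ} (hN : 0 < l * m) :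
    (LinearMap.range (codeMap hh b ν hρ hN) : Set (Matrix (Fin n) (Fin n) (AdjoinRoot hhat))) =
      code hh b m l ν ρ := by
  ext M
  simp only [code, S, SetLike.mem_coe, LinearMap.mem_range, Set.mem_image, mem_A_iff ν ρ hN]
  constructor
  · rintro ⟨c, rfl⟩
    exact ⟨_, ⟨_, ⟨c, rfl⟩, rfl⟩, rfl⟩
  · rintro ⟨_, ⟨_, ⟨c, rfl⟩, rfl⟩, rfl⟩
    exact ⟨c, rfl⟩

theorem isLinearMRD_code [Fact (Irreducible hhat)] (hf : Irreducible f) {m l : ℕ}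
    (hm : IsDegree f m) (h1 : 1 < m) (hmonic : f.coeff m = 1) (hd : hhat.natDegree = m)
    (hn : orderOf (sigma K) = n) (hl : 1 < l) (hln : l < n) (ν : K) (ρ : K ≃+* K)
    [FiniteDimensional k (F K)] (hρ : ∀ r : k, ρ (algebraMap k K r) = algebraMap k K r)
    (hν : Algebra.norm k ν ≠ 1 / Algebra.norm k (f.coeff 0) ^ l) :
    IsLinearMRD k (code hh b m l ν ρ) (n - l + 1) := by
  have hN : 0 < l * m := by positivity
  have hn1 : 1 < orderOf (sigma K) := by omega
  have := V.finite_F (K := K) hn1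
  have : Module.Finite (F K) (AdjoinRoot hhat) := hh.monic.finite_adjoinRoot
  have : Module.Finite k K := Module.Finite.trans (F K) K
  have hfin : Module.Finite k (AdjoinRoot hhat) := Module.Finite.trans (F K) _
  have hrank : ∀ c : Fin (l * m) → K, twisted ν ρ hN c ≠ 0 →
      n - l + 1 ≤ (codeMap hh b ν hρ hN c).rank := fun c hc =>
    finrank_lt_rank_toMatrix b _ (finrank_ker_L_lt hh hf hm h1 hmonic hd hn1 ν ρ hρ hν
      (by omega) hN hc) hln.le
  have hinj : Function.Injective (codeMap hh b ν hρ hN) := by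
    rw [← LinearMap.ker_eq_bot, LinearMap.ker_eq_bot']
    intro c hc
    have h0 : twisted ν ρ hN c = 0 := by
      by_contra h
      have := hrank c h
      rw [hc, Matrix.rank_zero] at this
      omega
    funext i
    rw [← coeff_twisted_of_lt ν ρ hN c i, h0]
    rfl
  have hrank' : ∀ M ∈ LinearMap.range (codeMap hh b ν hρ hN), M ≠ 0 → n - l + 1 ≤ M.rank := by
    rintro _ ⟨c, rfl⟩ hM
    refine hrank c fun h => hM ?_
    change LinearMap.toMatrix b b (L hh (Submodule.Quotient.mk (twisted ν ρ hN c))) = 0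
    rw [h, Submodule.Quotient.mk_zero, map_zero, map_zero]
  -- `lm[K:k] = lmn[F:k] = nl[E:k]`.
  have hdim : Module.finrank k (LinearMap.range (codeMap hh b ν hρ hN)) =
      n * l * Module.finrank k (AdjoinRoot hhat) := by
    rw [LinearMap.finrank_range_of_inj hinj, Module.finrank_pi_fintype, Finset.sum_const,
      Finset.card_univ, Fintype.card_fin, smul_eq_mul,
      ← Module.finrank_mul_finrank k (F K) K, finrank_F K (by omega), hn,
      ← Module.finrank_mul_finrank k (F K) (AdjoinRoot hhat), V.finrank_F_E hd]
    ring
  have hpos : 0 < Module.finrank k (AdjoinRoot hhat) := Module.finrank_pos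
  refine ⟨hfin, ?_, _, range_codeMap hh b ν hρ hN, ?_⟩
  · rw [← range_codeMap hh b ν hρ hN]
    constructor
    -- With `r = l - 1` the dimension `nl[E:k]` exceeds `nr[E:k]`, giving a nonzero codeword of rank
    -- at most `n - l + 1`.
    · obtain ⟨M, hM, hM0, hMr⟩ := exists_rank_le (LinearMap.range (codeMap hh b ν hρ hN))
        (r := l - 1) (by omega) (by
          rw [hdim]
          exact Nat.mul_lt_mul_of_pos_right
            (Nat.mul_lt_mul_of_pos_left (by omega) (by omega)) hpos)
      refine ⟨M, hM, 0, Submodule.zero_mem _, hM0, ?_⟩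
      rw [sub_zero]
      have := hrank' M hM hM0
      omega
    · rintro _ ⟨M, hM, N, hN', hMN, rfl⟩
      exact hrank' _ (Submodule.sub_mem _ hM hN') (sub_ne_zero.2 hMN)
  · rw [hdim, show n - (n - l + 1) + 1 = l by omega]

end Code

end SkewMRD

end

/-! ### The main theorem -/

theorem mainTheorem7 {K : Type*} [Field K] [MulSemiringAction (Multiplicative ℕ) K]
    (n m l : ℕ) (hn : orderOf (SkewMRD.sigma K) = n) (hm : 1 < m) (hl : 1 < l) (hln : l < n)
    (ρ : K ≃+* K) (hρ : FiniteDimensional (SkewMRD.F' K ρ) (SkewMRD.F K))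
    (f : SkewPolynomial K) (hirr : Irreducible f) (hdeg : SkewMRD.deg f = m)
    (hmonic : f.coeff m = 1)
    (hhat : Polynomial (SkewMRD.F K)) (hh : SkewMRD.IsMCLM f hhat)
    (hdegh : SkewMRD.deg (SkewMRD.central K hhat) = (m * n : ℕ))
    (ν : K)
    (hν : Algebra.norm (SkewMRD.F' K ρ) ν ≠ 1 / Algebra.norm (SkewMRD.F' K ρ) (f.coeff 0) ^ l) :
    IsField (AdjoinRoot hhat) ∧
    SkewMRD.rightNucleus hh =
      Set.range (fun p : Polynomial (SkewMRD.F K) => SkewMRD.V.mk hh (SkewMRD.central K p)) ∧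
    Module.finrank (AdjoinRoot hhat) (SkewMRD.V f hhat hh) = n ∧
    ∀ b : Module.Basis (Fin n) (AdjoinRoot hhat) (SkewMRD.V f hhat hh),
      SkewMRD.IsLinearMRD (SkewMRD.F' K ρ) (SkewMRD.code hh b m l ν ρ) (n - l + 1) := by
  have hn1 : 1 < orderOf (SkewMRD.sigma K) := by omega
  have hfm := SkewMRD.isDegree_of_deg hdeg
  -- The degree of `hhat(t^n)` is `n · deg hhat`, and it equals `mn`.
  have hd : hhat.natDegree = m := by
    have h := (SkewMRD.isDegree_central (by omega) hh.monic.ne_zero).unique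
      (SkewMRD.isDegree_of_deg hdegh)
    rw [hn, mul_comm] at h
    exact Nat.eq_of_mul_eq_mul_right (by omega) h
  have : Fact (Irreducible hhat) :=
    ⟨SkewMRD.V.irreducible_hhat hh hirr hfm (by omega) (by omega)⟩
  exact ⟨Field.toIsField _, SkewMRD.V.rightNucleus_eq hh hirr hfm hm hd hn1,
    (SkewMRD.V.finrank_E_V hh hfm hm hd hn1).trans hn,
    fun b => SkewMRD.isLinearMRD_code hh b hirr hfm hm hmonic hd hn hl hln ν ρ
      (fun r => r.2) hν⟩
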